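/- Let $M$ be a connected Riemannian manifold with (possibly empty) smooth boundary, let $E \to M$ be a Riemannian or Hermitian vector bundle over $\mathbb{F} = \mathbb{R}$ or $\mathbb{F} = \mathbb{C}$ respectively, endowed with a (not necessarily metric) connection $\nabla$, and let $D \colon \Gamma(E) \to \Gamma(E)$ be a (not necessarily elliptic) differential operator of finite order on smooth sections. Let $a, b \colon \partial M \to \mathbb{F}$ be arbitrary functions and let $n$ be the inward pointing unit normal to $\partial M$. Consider $D$ as an unbounded operator in $L^2(E)$ with domain $$\mathcal{D}(D) = \{ \eta \in \Gamma_c(E) : a \nabla_n \eta + b \eta = 0 \text{ on } \partial M \},$$ where $\Gamma_c(E)$ is the space of compactly supported smooth sections (there is no condition if $\partial M = \emptyset$), and let $\overline{D}$ be its closure. Let $\Gamma$ be a group of automorphisms of the vector bundle $E$ that preserve the metric of $E$, such that the induced maps on $M$ are isometries and $D(g_* \eta) = g_*(D\eta)$ for all $g \in \Gamma$ and $\eta \in \Gamma(E)$, where $g_*\eta = g \circ \eta \circ g^{-1}$. If $M$ has non-empty boundary, assume that $\nabla$, $a$ and $b$ are $\Gamma$-invariant along the boundary; that is, for all $g \in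 \Gamma$, $x \in \partial M$, $v \in T_xM$ and $\eta \in \Gamma(E)$, $$\nabla_{g_* v}(g_*\eta) = g(\nabla_v \eta), \qquad a(gx) = a(x), \qquad b(gx) = b(x).$$ Suppose that for every compact $K \subset M$ there exists $g \in \Gamma$ with $gK \cap K = \emptyset$. Then $\sigma_{\mathrm{ap}}(\overline{D}) = \sigma_W(\overline{D})$, and $\overline{D}$ has no eigenvalues of finite multiplicity (that is, for every $\lambda \in \mathbb{F}$ the space $\ker(\overline{D} - \lambda)$ is either zero or infinite dimensional). Here, for an unbounded operator $A$ with domain $\mathcal{D}(A)$ in a Hilbert space over $\mathbb{F}$, the approximate point spectrum $\sigma_{\mathrm{ap}}(A)$ is the set of all $\lambda \in \mathbb{F}$ for which there is a sequence $v_k \in \mathcal{D}(A)$ with $\|v_k\| = 1$ and $(A - \lambda)v_k \to 0$; the Weyl spectrum $\sigma_W(A)$ is the set of all $\lambda \in \mathbb{F}$ for which there is such a sequence that in addition converges weakly to $0$. -/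

import Mathlib

open Set Filter MeasureTheory Bundle
open scoped Topology Manifold ContDiff

set_option linter.unusedSectionVars false

noncomputable section
namespace SectionOperator

section Volume

variable {m : ℕ} {H : Type*} [TopologicalSpace H]
  (I : ModelWithCorners ℝ (EuclideanSpace ℝ (Fin m)) H)
  {M : Type*} [TopologicalSpace M] [ChartedSpace H M] [IsManifold I ∞ M]
  [RiemannianBundle (fun x : M => TangentSpace I x)]

/-- The `i`-th coordinate vector field `∂/∂xᵢ` at `p` of the preferred chart at `c`. -/
def coordVector (c p : M) (i : Fin m) : TangentSpace I p :=
  (trivializationAt (EuclideanSpace ℝ (Fin m)) (fun x : M => TangentSpace I x) c).symmL ℝ p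
    (EuclideanSpace.basisFun (Fin m) ℝ i)

/-- The Riemannian density `√(det gᵢⱼ)` at `p` in the coordinates of the preferred chart at `c`. -/
def volumeDensity (c p : M) : ℝ :=
  Real.sqrt (Matrix.gram ℝ (coordVector I c p)).det

/-- The measure `√(det gᵢⱼ) dx¹ ⋯ dxᵐ` on the domain of the preferred chart at `c`,
seen as a measure on `M` that vanishes outside of this domain. -/
def chartVolume [MeasurableSpace M] (c : M) : Measure M :=
  ((volume.restrict (extChartAt I c).target).withDensity
    (fun y => ENNReal.ofReal (volumeDensity I c ((extChartAt I c).symm y)))).map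
    (extChartAt I c).symm

variable (M) in
/-- The Riemannian volume measure: the least measure that dominates
`√(det gᵢⱼ) dx¹ ⋯ dxᵐ` on each chart domain. These measures agree on overlaps. -/
def riemannianVolume [MeasurableSpace M] : Measure M := ⨆ c : M, chartVolume I c

lemma tangentCoordChange_symmL {c d p : M} (hc : p ∈ (chartAt H c).source)
    (hd : p ∈ (chartAt H d).source) (v : EuclideanSpace ℝ (Fin m)) :
    (trivializationAt (EuclideanSpace ℝ (Fin m)) (fun x : M => TangentSpace I x) c).symmL ℝ p
        (tangentCoordChange I d c p v)
      = (trivializationAt (EuclideanSpace ℝ (Fin m)) (fun x : M => TangentSpace I x) d).symmL ℝ p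
        v := by
  rw [TangentBundle.symmL_trivializationAt_eq_core hc,
    TangentBundle.symmL_trivializationAt_eq_core hd]
  exact tangentCoordChange_comp (I := I) (w := d) (x := c) (y := p) (z := p)
    ⟨⟨by simpa using hd, by simpa using hc⟩, by simp⟩

lemma coordVector_eq_sum {c d p : M} (hc : p ∈ (chartAt H c).source)
    (hd : p ∈ (chartAt H d).source) (i : Fin m) :
    coordVector I d p i = ∑ k, (tangentCoordChange I d c p
      (EuclideanSpace.basisFun (Fin m) ℝ i)) k • coordVector I c p k := by
  rw [coordVector, ← tangentCoordChange_symmL I hc hd]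
  simp only [coordVector, ← map_smul, ← map_sum]
  congr 1
  conv_lhs => rw [← (EuclideanSpace.basisFun (Fin m) ℝ).sum_repr
    (tangentCoordChange I d c p (EuclideanSpace.basisFun (Fin m) ℝ i))]
  simp

lemma volumeDensity_change {c d p : M} (hc : p ∈ (chartAt H c).source)
    (hd : p ∈ (chartAt H d).source) :
    volumeDensity I d p = |(tangentCoordChange I d c p).det| * volumeDensity I c p := by
  set J : Matrix (Fin m) (Fin m) ℝ := LinearMap.toMatrix
    (EuclideanSpace.basisFun (Fin m) ℝ).toBasis (EuclideanSpace.basisFun (Fin m) ℝ).toBasis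
    (tangentCoordChange I d c p).toLinearMap with hJ
  have hJe : ∀ k i, J k i = (tangentCoordChange I d c p
      (EuclideanSpace.basisFun (Fin m) ℝ i)) k := by
    intro k i
    simp [hJ, LinearMap.toMatrix_apply]
  have hdet : (tangentCoordChange I d c p).det = J.det := by
    rw [hJ, ContinuousLinearMap.det, LinearMap.det_toMatrix]
  have hG : Matrix.gram ℝ (coordVector I d p)
      = J.transpose * Matrix.gram ℝ (coordVector I c p) * J := by
    ext i j
    rw [Matrix.gram_apply, coordVector_eq_sum I hc hd i, coordVector_eq_sum I hc hd j]
    simp only [Matrix.mul_apply, Matrix.transpose_apply, Matrix.gram_apply, sum_inner, inner_sum,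
      inner_smul_left, inner_smul_right, hJe, Finset.sum_mul]
    refine Finset.sum_congr rfl fun k _ => ?_
    rw [Finset.mul_sum]
    refine Finset.sum_congr rfl fun l _ => ?_
    simp only [conj_trivial]
    ring
  rw [volumeDensity, hG, Matrix.det_mul, Matrix.det_mul, Matrix.det_transpose, hdet, volumeDensity,
    show J.det * (Matrix.gram ℝ (coordVector I c p)).det * J.det
      = J.det ^ 2 * (Matrix.gram ℝ (coordVector I c p)).det by ring,
    Real.sqrt_mul (sq_nonneg _), Real.sqrt_sq_eq_abs]

lemma volumeDensity_pos {c p : M} (hc : p ∈ (chartAt H c).source) :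
    0 < volumeDensity I c p := by
  apply Real.sqrt_pos.2
  refine (Matrix.posDef_gram_of_linearIndependent ?_).det_pos
  have := (EuclideanSpace.basisFun (Fin m) ℝ).toBasis.linearIndependent
  have hb : p ∈ (trivializationAt (EuclideanSpace ℝ (Fin m))
    (fun x : M => TangentSpace I x) c).baseSet := by simpa using hc
  have h2 := this.map' ((trivializationAt (EuclideanSpace ℝ (Fin m))
    (fun x : M => TangentSpace I x) c).symmL ℝ p).toLinearMap ?_
  · have he : coordVector I c p = ((trivializationAt (EuclideanSpace ℝ (Fin m))
        (fun x : M => TangentSpace I x) c).symmL ℝ p).toLinearMap ∘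
        (EuclideanSpace.basisFun (Fin m) ℝ).toBasis := by
      ext i
      simp [coordVector]
    rw [he]
    exact h2
  · rw [LinearMap.ker_eq_bot]
    intro v w h
    have := congrArg ((trivializationAt (EuclideanSpace ℝ (Fin m))
      (fun x : M => TangentSpace I x) c).continuousLinearMapAt ℝ p) h
    simpa [Trivialization.continuousLinearMapAt_symmL _ hb] using this

lemma continuousOn_volumeDensity
    [IsContMDiffRiemannianBundle I ∞ (EuclideanSpace ℝ (Fin m)) (fun x : M => TangentSpace I x)]
    (c : M) : ContinuousOn (volumeDensity I c) (chartAt H c).source := by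
  have hloc : ∀ i, ContMDiffOn I (I.prod 𝓘(ℝ, EuclideanSpace ℝ (Fin m))) ∞
      (fun p : M => (TotalSpace.mk' (EuclideanSpace ℝ (Fin m)) p (coordVector I c p i) :
        TotalSpace (EuclideanSpace ℝ (Fin m)) (fun x : M => TangentSpace I x)))
      (chartAt H c).source := by
    intro i
    have := (trivializationAt (EuclideanSpace ℝ (Fin m))
      (fun x : M => TangentSpace I x) c).contMDiffOn_localFrame_baseSet (I := I) ∞
      (EuclideanSpace.basisFun (Fin m) ℝ).toBasis i
    rw [TangentBundle.trivializationAt_baseSet] at this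
    refine this.congr fun p hp => ?_
    have hp' : p ∈ (trivializationAt (EuclideanSpace ℝ (Fin m))
        (fun x : M => TangentSpace I x) c).baseSet := by simpa using hp
    rw [Trivialization.localFrame_apply_of_mem_baseSet _ _ hp']
    congr 1
    simp [coordVector, Trivialization.basisAt, Trivialization.symmL_apply _ hp']
  refine ContinuousOn.sqrt ?_
  have hdet : Continuous (fun A : Matrix (Fin m) (Fin m) ℝ => A.det) := continuous_id.matrix_det
  refine hdet.comp_continuousOn ?_
  refine continuousOn_pi.2 fun i => continuousOn_pi.2 fun j => ?_
  exact ((hloc i).inner_bundle (hloc j)).continuousOn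

variable [MeasurableSpace M] [BorelSpace M]

lemma chart_leftInv {c p : M} (h : p ∈ (chartAt H c).source) :
    (extChartAt I c).symm (extChartAt I c p) = p :=
  (extChartAt I c).left_inv (by simpa using h)

lemma measurableSet_target (c : M) : MeasurableSet (extChartAt I c).target := by
  rw [extChartAt_target]
  exact ((chartAt H c).open_target.preimage I.continuous_symm).measurableSet.inter
    I.isClosed_range.measurableSet

lemma aemeasurable_extChartAt_symm (c : M) :
    AEMeasurable (extChartAt I c).symm (volume.restrict (extChartAt I c).target) :=
  (continuousOn_extChartAt_symm c).aemeasurable (measurableSet_target I c)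

lemma measurableSet_image_extChartAt (c : M) {S : Set M} (hS : MeasurableSet S)
    (hSc : S ⊆ (chartAt H c).source) : MeasurableSet (extChartAt I c '' S) := by
  have h : extChartAt I c '' S = (extChartAt I c).target ∩ (extChartAt I c).symm ⁻¹' S := by
    rw [PartialEquiv.image_eq_target_inter_inv_preimage]
    simpa using hSc
  have hm := ((continuousOn_extChartAt_symm (I := I) c).domRestrict.measurable) hS
  have := (measurableSet_target I c).subtype_image hm
  rw [h]
  convert this using 1
  ext y
  simp
  tauto

lemma chartVolume_apply (c : M) {S : Set M} (hS : MeasurableSet S) :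
    chartVolume I c S = ∫⁻ y in extChartAt I c '' (S ∩ (chartAt H c).source),
      ENNReal.ofReal (volumeDensity I c ((extChartAt I c).symm y)) := by
  have hae : AEMeasurable (extChartAt I c).symm
      ((volume.restrict (extChartAt I c).target).withDensity
        (fun y => ENNReal.ofReal (volumeDensity I c ((extChartAt I c).symm y)))) :=
    (aemeasurable_extChartAt_symm I c).mono_ac (withDensity_absolutelyContinuous _ _)
  rw [chartVolume, Measure.map_apply_of_aemeasurable hae hS]
  have h : extChartAt I c '' (S ∩ (chartAt H c).source)
      = (extChartAt I c).symm ⁻¹' S ∩ (extChartAt I c).target := by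
    rw [PartialEquiv.image_eq_target_inter_inv_preimage _ (by simp)]
    ext y
    constructor
    · rintro ⟨h1, h2⟩
      exact ⟨h2.1, h1⟩
    · rintro ⟨h1, h2⟩
      exact ⟨h2, h1, by simpa using (extChartAt I c).map_target h2⟩
  rw [withDensity_apply', Measure.restrict_restrict', h]
  exact measurableSet_target I c

lemma chartVolume_eq (c d : M) {S : Set M} (hS : MeasurableSet S)
    (hSc : S ⊆ (chartAt H c).source) (hSd : S ⊆ (chartAt H d).source) :
    chartVolume I c S = chartVolume I d S := by
  rw [chartVolume_apply I c hS, chartVolume_apply I d hS, inter_eq_left.2 hSc, inter_eq_left.2 hSd]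
  have hmem : ∀ y ∈ extChartAt I d '' S, (extChartAt I d).symm y ∈ S := by
    rintro _ ⟨p, hp, rfl⟩
    rwa [chart_leftInv I (hSd hp)]
  have himg : extChartAt I c '' S
      = (extChartAt I c ∘ (extChartAt I d).symm) '' (extChartAt I d '' S) := by
    rw [image_image]
    refine image_congr fun p hp => ?_
    rw [Function.comp_apply, chart_leftInv I (hSd hp)]
  have hinj : InjOn (extChartAt I c ∘ (extChartAt I d).symm) (extChartAt I d '' S) := by
    rintro _ ⟨p, hp, rfl⟩ _ ⟨q, hq, rfl⟩ h
    simp only [Function.comp_apply] at h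
    rw [chart_leftInv I (hSd hp), chart_leftInv I (hSd hq)] at h
    rw [(extChartAt I c).injOn (by simpa using hSc hp) (by simpa using hSc hq) h]
  have hder : ∀ y ∈ extChartAt I d '' S, HasFDerivWithinAt
      (extChartAt I c ∘ (extChartAt I d).symm)
      (tangentCoordChange I d c ((extChartAt I d).symm y)) (extChartAt I d '' S) y := by
    rintro _ ⟨p, hp, rfl⟩
    rw [chart_leftInv I (hSd hp)]
    refine (hasFDerivWithinAt_tangentCoordChange (I := I)
      ⟨by simpa using hSd hp, by simpa using hSc hp⟩).mono ?_
    rintro _ ⟨q, hq, rfl⟩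
    simp [extChartAt]
  rw [himg, lintegral_image_eq_lintegral_abs_det_fderiv_mul volume
    (measurableSet_image_extChartAt I d hS hSd) hder hinj]
  refine setLIntegral_congr_fun (measurableSet_image_extChartAt I d hS hSd) fun y hy => ?_
  have hyS := hmem y hy
  simp only [Function.comp_apply]
  rw [chart_leftInv I (hSc hyS),
    volumeDensity_change I (hSc hyS) (hSd hyS), ENNReal.ofReal_mul (abs_nonneg _)]

/-- On a chart domain the Riemannian volume is `√(det gᵢⱼ) dx¹ ⋯ dxᵐ`. -/
lemma riemannianVolume_eq_chartVolume (c : M) {S : Set M} (hS : MeasurableSet S)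
    (hSc : S ⊆ (chartAt H c).source) : riemannianVolume I M S = chartVolume I c S := by
  refine le_antisymm ?_ (le_iSup (fun c : M => chartVolume I c) c S)
  have hU : MeasurableSet (chartAt H c).source := (chartAt H c).open_source.measurableSet
  have key : riemannianVolume I M ≤
      chartVolume I c + (⊤ : Measure M).restrict (chartAt H c).sourceᶜ := by
    refine iSup_le fun d => Measure.le_iff.2 fun T hT => ?_
    rw [← measure_inter_add_sdiff T hU, Measure.add_apply, Measure.restrict_apply hT]
    refine add_le_add ?_ ((le_top : chartVolume I d ≤ ⊤) _)
    have hV : MeasurableSet (chartAt H d).source := (chartAt H d).open_source.measurableSet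
    have h1 : chartVolume I d (T ∩ (chartAt H c).source)
        = chartVolume I d ((T ∩ (chartAt H c).source) ∩ (chartAt H d).source) := by
      rw [chartVolume_apply I d (hT.inter hU), chartVolume_apply I d ((hT.inter hU).inter hV),
        inter_assoc _ (chartAt H d).source, inter_self]
    rw [h1, chartVolume_eq I d c ((hT.inter hU).inter hV) inter_subset_right
      (inter_subset_left.trans inter_subset_right)]
    exact measure_mono (inter_subset_left.trans inter_subset_left)
  refine (key S).trans ?_
  rw [Measure.add_apply, Measure.restrict_apply hS,
    (disjoint_compl_right_iff_subset.2 hSc).inter_eq]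
  simp

variable [IsContMDiffRiemannianBundle I ∞ (EuclideanSpace ℝ (Fin m))
  (fun x : M => TangentSpace I x)]

instance isLocallyFiniteMeasure_riemannianVolume :
    IsLocallyFiniteMeasure (riemannianVolume I M) := by
  refine ⟨fun p => ?_⟩
  have := I.locallyCompactSpace
  have := ChartedSpace.locallyCompactSpace H M
  obtain ⟨K, hK, hKs, hKc⟩ := local_compact_nhds ((chartAt H p).open_source.mem_nhds
    (mem_chart_source H p))
  refine ⟨interior K, interior_mem_nhds.2 hK, ?_⟩
  rw [riemannianVolume_eq_chartVolume I p isOpen_interior.measurableSet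
    (interior_subset.trans hKs), chartVolume_apply I p isOpen_interior.measurableSet,
    inter_eq_left.2 (interior_subset.trans hKs)]
  have hcont : ContinuousOn (extChartAt I p) K :=
    (continuousOn_extChartAt p).mono (by simpa using hKs)
  have hc := hKc.image_of_continuousOn hcont
  have hdens : ContinuousOn (fun y => volumeDensity I p ((extChartAt I p).symm y))
      (extChartAt I p '' K) := by
    have hsub : extChartAt I p '' K ⊆ (extChartAt I p).target := by
      rintro _ ⟨q, hq, rfl⟩
      exact (extChartAt I p).map_source (by simpa using hKs hq)
    refine (continuousOn_volumeDensity I p).comp ((continuousOn_extChartAt_symm p).mono hsub) ?_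
    intro y hy
    simpa using (extChartAt I p).map_target (hsub hy)
  refine lt_of_le_of_lt (lintegral_mono_set (image_mono interior_subset)) ?_
  have hint := (hdens.integrableOn_compact (μ := volume) hc)
  exact (lintegral_mono fun y => Real.ofReal_le_enorm _).trans_lt hint.2

instance isOpenPosMeasure_riemannianVolume :
    (riemannianVolume I M).IsOpenPosMeasure := by
  refine ⟨fun U hU ⟨p, hp⟩ h0 => ?_⟩
  set S := U ∩ (chartAt H p).source with hSdef
  have hSo : IsOpen S := hU.inter (chartAt H p).open_source
  have hpS : p ∈ S := ⟨hp, mem_chart_source H p⟩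
  have h1 : riemannianVolume I M S = 0 := measure_mono_null inter_subset_left h0
  rw [riemannianVolume_eq_chartVolume I p hSo.measurableSet inter_subset_right,
    chartVolume_apply I p hSo.measurableSet, inter_eq_left.2 inter_subset_right] at h1
  have hms := measurableSet_image_extChartAt I p hSo.measurableSet inter_subset_right
  have hsub : extChartAt I p '' S ⊆ (extChartAt I p).target := by
    rintro _ ⟨q, hq, rfl⟩
    exact (extChartAt I p).map_source (by simpa using hq.2)
  have hdens : ContinuousOn (fun y => volumeDensity I p ((extChartAt I p).symm y))
      (extChartAt I p '' S) := by
    refine (continuousOn_volumeDensity I p).comp ((continuousOn_extChartAt_symm p).mono hsub) ?_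
    intro y hy
    simpa using (extChartAt I p).map_target (hsub hy)
  rw [lintegral_eq_zero_iff' (hdens.aemeasurable hms).ennreal_ofReal] at h1
  have h2 : ∀ᵐ y ∂(volume.restrict (extChartAt I p '' S)), False := by
    filter_upwards [h1, ae_restrict_mem hms] with y hy hyS
    have hpos := volumeDensity_pos I (c := p) (p := (extChartAt I p).symm y)
      (by simpa using (extChartAt I p).map_target (hsub hyS))
    simp only [Pi.zero_apply, ENNReal.ofReal_eq_zero] at hy
    linarith
  rw [ae_iff] at h2
  simp only [not_false_eq_true, ofPred_true, Measure.restrict_apply_univ] at h2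
  have hnhds : extChartAt I p '' S ∈ 𝓝[range I] (extChartAt I p p) := by
    rw [← map_extChartAt_nhds]
    exact image_mem_map (hSo.mem_nhds hpS)
  obtain ⟨O, hO, hpO, hOS⟩ := mem_nhdsWithin.1 hnhds
  have hcl : extChartAt I p p ∈ closure (interior (range I)) :=
    I.range_subset_closure_interior (by simp [extChartAt])
  obtain ⟨y, hyO, hyI⟩ := mem_closure_iff.1 hcl O hO hpO
  have hpos := (hO.inter isOpen_interior).measure_pos volume ⟨y, hyO, hyI⟩
  refine hpos.ne' (measure_mono_null ?_ h2)
  exact fun z hz => hOS ⟨hz.1, interior_subset hz.2⟩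

end Volume

section Sections

variable (𝕜 : Type*) [RCLike 𝕜] {m : ℕ} {H : Type*} [TopologicalSpace H]
  (I : ModelWithCorners ℝ (EuclideanSpace ℝ (Fin m)) H)
  {M : Type*} [TopologicalSpace M] [ChartedSpace H M]
  (F : Type*) [NormedAddCommGroup F] [NormedSpace 𝕜 F] [NormedSpace ℝ F] [IsScalarTower ℝ 𝕜 F]
  (V : M → Type*) [TopologicalSpace (TotalSpace F V)]
  [∀ x, NormedAddCommGroup (V x)] [∀ x, InnerProductSpace 𝕜 (V x)]
  [∀ x, NormedSpace ℝ (V x)]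
  [FiberBundle F V] [VectorBundle 𝕜 F V] [VectorBundle ℝ F V]

variable {V} in
/-- A section `η` of the bundle is smooth. -/
def IsSmoothSection (η : ∀ x, V x) : Prop :=
  ContMDiff I (I.prod 𝓘(ℝ, F)) ∞ (fun x => (TotalSpace.mk' F x (η x) : TotalSpace F V))

/-- The inner products of the fibers depend smoothly on the base point. -/
class IsSmoothMetricBundle : Prop where
  contMDiff_inner : ∀ σ τ : ∀ x, V x, IsSmoothSection I F σ → IsSmoothSection I F τ →
    ContMDiff I 𝓘(ℝ, 𝕜) ∞ (fun x => inner 𝕜 (σ x) (τ x))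

/-- The space of smooth sections. -/
def smoothSections : Submodule 𝕜 (∀ x, V x) where
  carrier := {η | IsSmoothSection I F η}
  zero_mem' := contMDiff_zeroSection ℝ V
  add_mem' hη hθ := ContMDiff.add_section hη hθ
  smul_mem' c η hη := by
    intro x₀
    have h := (contMDiffAt_section x₀).1 (hη x₀)
    refine (contMDiffAt_section x₀).2 ?_
    have h2 : ContMDiffAt I 𝓘(ℝ, F) ∞
        (fun x => c • (trivializationAt F V x₀ ⟨x, η x⟩).2) x₀ :=
      ((contDiff_const_smul (𝕜 := ℝ) (n := ∞) (F := F) c).contMDiff.contMDiffAt).comp x₀ h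
    refine h2.congr_of_eventuallyEq ?_
    filter_upwards [(trivializationAt F V x₀).open_baseSet.mem_nhds
      (mem_baseSet_trivializationAt F V x₀)] with x hx
    exact ((trivializationAt F V x₀).linear 𝕜 hx).2 c (η x)

/-- The smooth sections with compact support. -/
def compactlySupported : Submodule 𝕜 (smoothSections 𝕜 I F V) where
  carrier := {η | IsCompact (closure {x | η.1 x ≠ 0})}
  zero_mem' := by simp
  add_mem' {η θ} hη hθ := by
    refine (hη.union hθ).of_isClosed_subset isClosed_closure ?_
    rw [← closure_union]
    refine closure_mono fun x hx => ?_
    by_contra h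
    simp only [mem_union, mem_ofPred_eq, ne_eq, not_or, not_not] at h
    exact hx (by simp [h.1, h.2])
  smul_mem' c η hη := by
    refine IsCompact.of_isClosed_subset hη isClosed_closure (closure_mono fun x hx h => hx ?_)
    simp [h]

/-- The type of compactly supported smooth sections, to be normed by the `L²` inner product. -/
def CompactSections : Type _ := compactlySupported 𝕜 I F V

instance : AddCommGroup (CompactSections 𝕜 I F V) :=
  inferInstanceAs (AddCommGroup (compactlySupported 𝕜 I F V))

instance : Module 𝕜 (CompactSections 𝕜 I F V) :=
  inferInstanceAs (Module 𝕜 (compactlySupported 𝕜 I F V))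

variable {𝕜 I F V}

/-- The underlying smooth section of a compactly supported one. -/
def CompactSections.toSmooth : CompactSections 𝕜 I F V →ₗ[𝕜] smoothSections 𝕜 I F V :=
  (compactlySupported 𝕜 I F V).subtype

lemma CompactSections.continuous_inner [IsSmoothMetricBundle 𝕜 I F V]
    (η θ : CompactSections 𝕜 I F V) :
    Continuous (fun x => inner 𝕜 (η.toSmooth.1 x) (θ.toSmooth.1 x)) :=
  (IsSmoothMetricBundle.contMDiff_inner _ _ η.toSmooth.2 θ.toSmooth.2).continuous

lemma CompactSections.hasCompactSupport_inner [T2Space M] (η θ : CompactSections 𝕜 I F V) :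
    HasCompactSupport (fun x => inner 𝕜 (η.toSmooth.1 x) (θ.toSmooth.1 x)) := by
  refine IsCompact.of_isClosed_subset (show IsCompact (closure {x | η.toSmooth.1 x ≠ 0}) from η.2)
    isClosed_closure (closure_mono fun x hx h => hx ?_)
  simp [h]

variable [T2Space M] [IsManifold I ∞ M] [RiemannianBundle (fun x : M => TangentSpace I x)]
  [IsContMDiffRiemannianBundle I ∞ (EuclideanSpace ℝ (Fin m)) (fun x : M => TangentSpace I x)]
  [MeasurableSpace M] [BorelSpace M] [IsSmoothMetricBundle 𝕜 I F V]

lemma CompactSections.integrable_inner (η θ : CompactSections 𝕜 I F V) :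
    Integrable (fun x => inner 𝕜 (η.toSmooth.1 x) (θ.toSmooth.1 x)) (riemannianVolume I M) :=
  (η.continuous_inner θ).integrable_of_hasCompactSupport (η.hasCompactSupport_inner θ)

variable (𝕜 I F V) in
/-- The `L²` inner product `⟨η, θ⟩ = ∫_M ⟨η x, θ x⟩` on compactly supported smooth sections. -/
@[reducible]
def CompactSections.innerCore : InnerProductSpace.Core 𝕜 (CompactSections 𝕜 I F V) where
  inner η θ := ∫ x, inner 𝕜 (η.toSmooth.1 x) (θ.toSmooth.1 x) ∂(riemannianVolume I M)
  conj_inner_symm η θ := by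
    rw [← integral_conj]
    simp
  re_inner_nonneg η := by
    rw [← integral_re (η.integrable_inner η)]
    exact integral_nonneg fun x => inner_self_nonneg
  add_left η θ ζ := by
    rw [← integral_add (η.integrable_inner ζ) (θ.integrable_inner ζ)]
    simp [inner_add_left]
  smul_left η θ c := by
    rw [← integral_const_mul]
    simp [inner_smul_left]
  definite η h := by
    have hre : ∫ x, RCLike.re (inner 𝕜 (η.toSmooth.1 x) (η.toSmooth.1 x))
        ∂(riemannianVolume I M) = 0 := by
      rw [integral_re (η.integrable_inner η), h, map_zero]
    have hc : Continuous fun x => RCLike.re (inner 𝕜 (η.toSmooth.1 x) (η.toSmooth.1 x)) :=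
      RCLike.continuous_re.comp (η.continuous_inner η)
    rw [integral_eq_zero_iff_of_nonneg (fun x => inner_self_nonneg)
      (η.integrable_inner η).re] at hre
    have h0 := (Continuous.ae_eq_iff_eq (riemannianVolume I M) hc continuous_const).1 hre
    have hη : η.toSmooth = 0 := by
      refine Subtype.ext (funext fun x => ?_)
      exact re_inner_self_nonpos.1 (congrFun h0 x).le
    exact Subtype.ext hη

instance : NormedAddCommGroup (CompactSections 𝕜 I F V) :=
  (CompactSections.innerCore 𝕜 I F V).toNormedAddCommGroup

instance : InnerProductSpace 𝕜 (CompactSections 𝕜 I F V) :=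
  InnerProductSpace.ofCore (CompactSections.innerCore 𝕜 I F V).toCore

variable (𝕜 I F V) in
/-- The Hilbert space `L²(E)`: the completion of the space of compactly supported smooth sections
with respect to the `L²` inner product. -/
abbrev L2Sections : Type _ := UniformSpace.Completion (CompactSections 𝕜 I F V)

variable (𝕜 I F V) in
/-- The inclusion of the compactly supported smooth sections in `L²(E)`. -/
def CompactSections.toL2 : CompactSections 𝕜 I F V →ₗ[𝕜] L2Sections 𝕜 I F V :=
  (UniformSpace.Completion.toComplₗᵢ (𝕜 := 𝕜) (E := CompactSections 𝕜 I F V)).toLinearMap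

end Sections
section Boundary

variable {m : ℕ} {H : Type*} [TopologicalSpace H]
  (I : ModelWithCorners ℝ (EuclideanSpace ℝ (Fin m)) H)

/-- Manifolds with model `I` are manifolds with (possibly empty) smooth boundary: the model is
either the whole Euclidean space or a closed half-space. -/
class IsSmoothBoundaryModel : Prop where
  range_eq : range I = univ ∨
    ∃ l : EuclideanSpace ℝ (Fin m) →L[ℝ] ℝ, l ≠ 0 ∧ range I = {y | 0 ≤ l y}

instance (k : ℕ) : IsSmoothBoundaryModel (𝓡 k) := ⟨Or.inl (by simp)⟩

instance (k : ℕ) [NeZero k] : IsSmoothBoundaryModel (𝓡∂ k) := by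
  refine ⟨Or.inr ⟨EuclideanSpace.proj 0, fun h => ?_, ?_⟩⟩
  · have h1 := congrArg (fun f => f (EuclideanSpace.single (0 : Fin k) (1 : ℝ))) h
    simp at h1
  · rw [range_modelWithCornersEuclideanHalfSpace]
    rfl

variable {M : Type*} [TopologicalSpace M] [ChartedSpace H M]

/-- The coordinates of a tangent vector at `x` in the preferred chart at `x`. -/
def tangentCoord {x : M} (v : TangentSpace I x) : EuclideanSpace ℝ (Fin m) := v

/-- A vector at a boundary point is tangent to the boundary: in the preferred chart, it is
parallel to the boundary of the model half-space. -/
def IsTangentToBoundary {x : M} (v : TangentSpace I x) : Prop :=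
  ∀ᶠ t : ℝ in 𝓝 0, extChartAt I x x + t • tangentCoord I v ∈ frontier (range I)

/-- A vector at a boundary point points into the manifold: in the preferred chart, it points into
the interior of the model half-space. -/
def IsInwardPointing {x : M} (v : TangentSpace I x) : Prop :=
  ∀ᶠ t : ℝ in 𝓝[>] 0, extChartAt I x x + t • tangentCoord I v ∈ interior (range I)

/-- `n` is the inward pointing unit normal to the boundary at the boundary point `x`. -/
def IsInwardNormal [RiemannianBundle (fun x : M => TangentSpace I x)]
    {x : M} (n : TangentSpace I x) : Prop :=
  ‖n‖ = 1 ∧ (∀ v : TangentSpace I x, IsTangentToBoundary I v → inner ℝ n v = 0) ∧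
    IsInwardPointing I n

end Boundary

section Operators

variable (𝕜 : Type*) [RCLike 𝕜] {m : ℕ} {H : Type*} [TopologicalSpace H]
  (I : ModelWithCorners ℝ (EuclideanSpace ℝ (Fin m)) H)
  {M : Type*} [TopologicalSpace M] [ChartedSpace H M]
  (F : Type*) [NormedAddCommGroup F] [NormedSpace 𝕜 F] [NormedSpace ℝ F] [IsScalarTower ℝ 𝕜 F]
  (V : M → Type*) [TopologicalSpace (TotalSpace F V)]
  [∀ x, NormedAddCommGroup (V x)] [∀ x, InnerProductSpace 𝕜 (V x)]
  [∀ x, NormedSpace ℝ (V x)]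
  [FiberBundle F V] [VectorBundle 𝕜 F V] [VectorBundle ℝ F V]

variable {V} in
/-- The section `η`, expressed in the preferred trivialization at `c`. -/
def localRep (c : M) (η : ∀ x, V x) (x : M) : F :=
  (trivializationAt F V c ⟨x, η x⟩).2

variable {V} in
/-- The iterated partial derivative `∂^k η / ∂x_{J 0} ⋯ ∂x_{J (k-1)}` at `x` of the section `η`,
expressed in the preferred chart and the preferred trivialization at `c`. -/
def partialDeriv (c : M) (η : ∀ x, V x) {k : ℕ} (J : Fin k → Fin m) (x : M) : F :=
  iteratedFDerivWithin ℝ k (fun y => localRep F c η ((extChartAt I c).symm y)) (range I)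
    (extChartAt I c x) (fun j => EuclideanSpace.basisFun (Fin m) ℝ (J j))

/-- A differential operator (of some finite order `d`) on the sections of `V`: a linear map on
smooth sections that is given in local coordinates and local trivializations by
`∑ A^J ∂_J`, with smooth matrix-valued coefficients `A^J`. The sum is taken over the words `J` of
length at most `d` in the coordinate indices, which represent all multi-indices of order at most
`d`. -/
structure DifferentialOperator where
  /-- The action on smooth sections. -/
  toLinearMap : smoothSections 𝕜 I F V →ₗ[𝕜] smoothSections 𝕜 I F V
  exists_local : ∃ d : ℕ, ∀ c : M, ∃ A : (k : ℕ) → (Fin k → Fin m) → M → (F →L[𝕜] F),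
    (∀ k J, ContMDiffOn I 𝓘(ℝ, F →L[𝕜] F) ∞ (A k J)
      ((chartAt H c).source ∩ (trivializationAt F V c).baseSet)) ∧
    ∀ η : smoothSections 𝕜 I F V,
      ∀ x ∈ (chartAt H c).source ∩ (trivializationAt F V c).baseSet,
        localRep F c (toLinearMap η).1 x
          = ∑ k ∈ Finset.range (d + 1), ∑ J : Fin k → Fin m,
              A k J x (partialDeriv I F c η.1 J x)

/-- A smooth connection on `V`, linear over `𝕜`. Here `toFun η x v` is `∇_v η` at `x`. -/
structure Connection [IsManifold I ∞ M] extends CovariantDerivative I F V where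
  map_smul : ∀ (c : 𝕜) (η : ∀ x, V x), IsSmoothSection I F η →
    ∀ (x : M) (v : TangentSpace I x), toFun (c • η) x v = c • toFun η x v
  smooth : CovariantDerivative.ContMDiffCovariantDerivative toCovariantDerivative ∞

variable {𝕜 I F V}

lemma DifferentialOperator.eq_zero_of_eventuallyEq (D : DifferentialOperator 𝕜 I F V)
    (η : smoothSections 𝕜 I F V) {x : M} (h : ∀ᶠ y in 𝓝 x, η.1 y = 0) :
    (D.toLinearMap η).1 x = 0 := by
  obtain ⟨d, hd⟩ := D.exists_local
  obtain ⟨A, -, hA⟩ := hd x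
  have hb := mem_baseSet_trivializationAt F V x
  have hlin := fun y (hy : y ∈ (trivializationAt F V x).baseSet) =>
    (trivializationAt F V x).linear 𝕜 hy
  have h0 : (fun y => localRep F x η.1 ((extChartAt I x).symm y))
      =ᶠ[𝓝[range I] (extChartAt I x x)] fun _ => 0 := by
    have h1 : ∀ᶠ y in 𝓝 x, localRep F x η.1 y = 0 := by
      filter_upwards [h, (trivializationAt F V x).open_baseSet.mem_nhds hb] with y hy hyb
      rw [localRep, hy]
      exact (hlin y hyb).mk'.map_zero
    rw [← map_extChartAt_nhds]
    refine Filter.eventually_map.2 ?_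
    filter_upwards [h1, (chartAt H x).open_source.mem_nhds (mem_chart_source H x)] with y hy hys
    rw [(extChartAt I x).left_inv (by simpa using hys), hy]
  have hx : localRep F x (D.toLinearMap η).1 x = 0 := by
    rw [hA η x ⟨mem_chart_source H x, hb⟩]
    refine Finset.sum_eq_zero fun k _ => Finset.sum_eq_zero fun J _ => ?_
    rw [partialDeriv, h0.iteratedFDerivWithin_eq (h0.eq_of_nhdsWithin (by simp [extChartAt]))]
    simp [iteratedFDerivWithin_fun_zero]
  refine ((trivializationAt F V x).linearEquivAt 𝕜 x hb).injective ?_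
  rw [map_zero]
  exact hx

/-- A differential operator acts on the compactly supported smooth sections. -/
def DifferentialOperator.onCompact (D : DifferentialOperator 𝕜 I F V) :
    CompactSections 𝕜 I F V →ₗ[𝕜] CompactSections 𝕜 I F V :=
  (D.toLinearMap ∘ₗ CompactSections.toSmooth).codRestrict (compactlySupported 𝕜 I F V) (by
    intro η
    refine IsCompact.of_isClosed_subset
      (show IsCompact (closure {x | η.toSmooth.1 x ≠ 0}) from η.2) isClosed_closure
      (closure_minimal (fun x hx => ?_) isClosed_closure)
    by_contra hxs
    refine hx (D.eq_zero_of_eventuallyEq _ ?_)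
    filter_upwards [isClosed_closure.isOpen_compl.mem_nhds hxs] with y hy
    by_contra hne
    exact hy (subset_closure hne))

variable [IsManifold I ∞ M] [RiemannianBundle (fun x : M => TangentSpace I x)]

lemma IsSmoothSection.mdifferentiableAt {η : ∀ x, V x} (h : IsSmoothSection I F η) (x : M) :
    MDifferentiableAt I (I.prod 𝓘(ℝ, F)) (fun x => (TotalSpace.mk' F x (η x) : TotalSpace F V)) x :=
  (h x).mdifferentiableAt (by simp)

/-- The compactly supported smooth sections `η` with `a ∇_n η + b η = 0` on the boundary, where `n`
is the inward pointing unit normal. If the boundary is empty, there is no condition. -/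
def boundaryDomain (nabla : Connection 𝕜 I F V) (a b : I.boundary M → 𝕜) :
    Submodule 𝕜 (CompactSections 𝕜 I F V) where
  carrier := {η | ∀ (x : I.boundary M) (n : TangentSpace I (x : M)), IsInwardNormal I n →
    a x • nabla.toFun η.toSmooth.1 x n + b x • η.toSmooth.1 x = 0}
  zero_mem' x n _ := by
    simp
  add_mem' {η θ} hη hθ x n hn := by
    have h := nabla.isCovariantDerivativeOnUniv.add
      (IsSmoothSection.mdifferentiableAt η.toSmooth.2 (x : M))
      (IsSmoothSection.mdifferentiableAt θ.toSmooth.2 (x : M))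
    have h1 : (η + θ).toSmooth.1 = η.toSmooth.1 + θ.toSmooth.1 := by simp
    rw [h1, h, Pi.add_apply, add_apply, smul_add, smul_add,
      add_add_add_comm, hη x n hn, hθ x n hn, add_zero]
  smul_mem' c η hη x n hn := by
    have h1 : (c • η).toSmooth.1 = c • η.toSmooth.1 := by simp
    rw [h1, nabla.map_smul c _ η.toSmooth.2, Pi.smul_apply, smul_comm _ c, smul_comm _ c,
      ← smul_add, hη x n hn, smul_zero]

variable [T2Space M]
  [IsContMDiffRiemannianBundle I ∞ (EuclideanSpace ℝ (Fin m)) (fun x : M => TangentSpace I x)]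
  [MeasurableSpace M] [BorelSpace M] [IsSmoothMetricBundle 𝕜 I F V]

lemma CompactSections.toL2_injective : Function.Injective (CompactSections.toL2 𝕜 I F V) :=
  (UniformSpace.Completion.toComplₗᵢ (𝕜 := 𝕜) (E := CompactSections 𝕜 I F V)).injective

/-- The differential operator `D` as an unbounded operator in `L²(E)`, with domain the compactly
supported smooth sections that satisfy the boundary condition. -/
def DifferentialOperator.unbounded (D : DifferentialOperator 𝕜 I F V)
    (nabla : Connection 𝕜 I F V) (a b : I.boundary M → 𝕜) :
    L2Sections 𝕜 I F V →ₗ.[𝕜] L2Sections 𝕜 I F V where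
  domain := (boundaryDomain nabla a b).map (CompactSections.toL2 𝕜 I F V)
  toFun := CompactSections.toL2 𝕜 I F V ∘ₗ D.onCompact ∘ₗ (boundaryDomain nabla a b).subtype ∘ₗ
    (Submodule.equivMapOfInjective (CompactSections.toL2 𝕜 I F V)
      CompactSections.toL2_injective (boundaryDomain nabla a b)).symm.toLinearMap

end Operators

section Automorphisms

variable (𝕜 : Type*) [RCLike 𝕜] {m : ℕ} {H : Type*} [TopologicalSpace H]
  (I : ModelWithCorners ℝ (EuclideanSpace ℝ (Fin m)) H)
  {M : Type*} [TopologicalSpace M] [ChartedSpace H M]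
  (F : Type*) [NormedAddCommGroup F] [NormedSpace 𝕜 F] [NormedSpace ℝ F] [IsScalarTower ℝ 𝕜 F]
  (V : M → Type*) [TopologicalSpace (TotalSpace F V)]
  [∀ x, NormedAddCommGroup (V x)] [∀ x, InnerProductSpace 𝕜 (V x)]
  [∀ x, NormedSpace ℝ (V x)]
  [FiberBundle F V] [VectorBundle 𝕜 F V] [VectorBundle ℝ F V]

/-- An automorphism of the vector bundle `V` that preserves the metric of `V`: a diffeomorphism of
the total space that maps the fiber over `x` by a linear isometry onto the fiber over the image
of `x` under a diffeomorphism of the base (the induced map). -/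
structure MetricBundleAut where
  /-- The diffeomorphism of the total space. -/
  total : Diffeomorph (I.prod 𝓘(ℝ, F)) (I.prod 𝓘(ℝ, F)) (TotalSpace F V) (TotalSpace F V) ∞
  /-- The induced diffeomorphism of the base. -/
  base : Diffeomorph I I M M ∞
  /-- The isometries of the fibers. -/
  fiber : ∀ x, V x ≃ₗᵢ[𝕜] V (base x)
  total_mk : ∀ x (v : V x), total ⟨x, v⟩ = ⟨base x, fiber x v⟩

variable {V} in
/-- The identification of the fibers over equal points. -/
def fiberCast {x y : M} (h : x = y) : V x ≃ₗᵢ[𝕜] V y := h ▸ LinearIsometryEquiv.refl 𝕜 (V x)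

variable {V} in
lemma mk_fiberCast {x y : M} (h : x = y) (v : V x) :
    (⟨y, fiberCast 𝕜 h v⟩ : TotalSpace F V) = ⟨x, v⟩ := by
  subst h
  rfl

namespace MetricBundleAut

variable {𝕜 I F V}

lemma ext_total {g h : MetricBundleAut 𝕜 I F V} (H : ∀ p, g.total p = h.total p) : g = h := by
  obtain ⟨gt, gb, gf, hg⟩ := g
  obtain ⟨ht, hb, hf, hh⟩ := h
  obtain rfl : gt = ht := Diffeomorph.ext H
  obtain rfl : gb = hb := by
    refine Diffeomorph.ext fun x => ?_
    have := (hg x 0).symm.trans (hh x 0)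
    exact congrArg TotalSpace.proj this
  obtain rfl : gf = hf := by
    funext x
    refine LinearIsometryEquiv.ext fun v => ?_
    have := (hg x v).symm.trans (hh x v)
    simpa using this
  rfl

/-- The identity automorphism. -/
protected def refl : MetricBundleAut 𝕜 I F V where
  total := Diffeomorph.refl _ _ _
  base := Diffeomorph.refl _ _ _
  fiber x := LinearIsometryEquiv.refl 𝕜 (V x)
  total_mk _ _ := rfl

/-- The composition `g ∘ h` of automorphisms. -/
protected def comp (g h : MetricBundleAut 𝕜 I F V) : MetricBundleAut 𝕜 I F V where
  total := h.total.trans g.total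
  base := h.base.trans g.base
  fiber x := (h.fiber x).trans (g.fiber (h.base x))
  total_mk x v := by
    simp only [Diffeomorph.coe_trans, Function.comp_apply]
    rw [h.total_mk, g.total_mk]
    rfl

/-- The inverse automorphism. -/
protected def symm (g : MetricBundleAut 𝕜 I F V) : MetricBundleAut 𝕜 I F V where
  total := g.total.symm
  base := g.base.symm
  fiber y := (fiberCast 𝕜 (g.base.apply_symm_apply y).symm).trans (g.fiber (g.base.symm y)).symm
  total_mk y v := by
    apply g.total.injective
    refine (g.total.apply_symm_apply ⟨y, v⟩).trans (Eq.trans ?_ (g.total_mk _ _).symm)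
    simp [mk_fiberCast]

instance : Mul (MetricBundleAut 𝕜 I F V) := ⟨MetricBundleAut.comp⟩
instance : One (MetricBundleAut 𝕜 I F V) := ⟨MetricBundleAut.refl⟩
instance : Inv (MetricBundleAut 𝕜 I F V) := ⟨MetricBundleAut.symm⟩

/-- The automorphisms form a group under composition. -/
instance : Group (MetricBundleAut 𝕜 I F V) :=
  Group.ofLeftAxioms (fun _ _ _ => ext_total fun _ => rfl) (fun _ => ext_total fun _ => rfl)
    (fun g => ext_total fun p => g.total.symm_apply_apply p)

/-- The push-forward `g_* η = g ∘ η ∘ g⁻¹` of a smooth section under an automorphism. -/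
def pushforward (g : MetricBundleAut 𝕜 I F V) (η : smoothSections 𝕜 I F V) :
    smoothSections 𝕜 I F V where
  val y := fiberCast 𝕜 (g.base.apply_symm_apply y) (g.fiber (g.base.symm y) (η.1 (g.base.symm y)))
  property := by
    have h := g.total.contMDiff.comp (ContMDiff.comp (g := fun x => TotalSpace.mk' F x (η.1 x))
      η.2 g.base.symm.contMDiff)
    refine h.congr fun y => ?_
    simp only [Function.comp_apply]
    rw [g.total_mk]
    exact mk_fiberCast 𝕜 F _ _

/-- The map induced by `g` on the base is an isometry of the Riemannian metric. -/
def IsIsometric [RiemannianBundle (fun x : M => TangentSpace I x)]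
    (g : MetricBundleAut 𝕜 I F V) : Prop :=
  ∀ (x : M) (v w : TangentSpace I x),
    inner ℝ (mfderiv I I g.base x v) (mfderiv I I g.base x w) = inner ℝ v w

end MetricBundleAut

end Automorphisms

section Spectrum

variable {𝕜 : Type*} [RCLike 𝕜] {W : Type*} [NormedAddCommGroup W] [InnerProductSpace 𝕜 W]

/-- The approximate point spectrum of an unbounded operator. -/
def approximatePointSpectrum (A : W →ₗ.[𝕜] W) : Set 𝕜 :=
  {z | ∃ v : ℕ → A.domain, (∀ k, ‖(v k : W)‖ = 1) ∧
    Tendsto (fun k => A (v k) - z • (v k : W)) atTop (𝓝 0)}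

/-- The Weyl spectrum of an unbounded operator. -/
def weylSpectrum (A : W →ₗ.[𝕜] W) : Set 𝕜 :=
  {z | ∃ v : ℕ → A.domain, (∀ k, ‖(v k : W)‖ = 1) ∧
    (∀ w : W, Tendsto (fun k => inner 𝕜 w (v k : W)) atTop (𝓝 0)) ∧
    Tendsto (fun k => A (v k) - z • (v k : W)) atTop (𝓝 0)}

/-- The eigenspace `ker (A - z)` of an unbounded operator. -/
def eigenspace (A : W →ₗ.[𝕜] W) (z : 𝕜) : Submodule 𝕜 A.domain :=
  LinearMap.ker (A.toFun - z • A.domain.subtype)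

/-- `z` is an eigenvalue of the unbounded operator `A`, and its multiplicity is finite. -/
def IsEigenvalueOfFiniteMultiplicity (A : W →ₗ.[𝕜] W) (z : 𝕜) : Prop :=
  eigenspace A z ≠ ⊥ ∧ FiniteDimensional 𝕜 (eigenspace A z)

end Spectrum

end SectionOperator
end

/-!
The closure of the operator `T = D.unbounded nabla a b` is studied through the isometries of `L²(E)`
given by push-forward under the elements of `Γ`.

An isometry of `M` preserves the Riemannian volume
(`IsRiemannianIsometry.measurePreserving_symm`: change of variables in charts, where the Gram
determinants of the coordinate fields transform by the square of the Jacobian determinant), so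
push-forward is an isometry for the `L²` inner product. A diffeomorphism maps the half-space of
inward directions at a boundary point onto that at its image, so an isometry preserves inward unit
normals and push-forward preserves the boundary condition. Since it also commutes with `D`, it
preserves the graph of `T`. If finitely many compactly supported sections are given, some `g ∈ Γ`
moves the union `K` of their supports off itself, so that each of their push-forwards is orthogonal
to all of them: `T` has displacing symmetries
(`DifferentialOperator.hasDisplacingSymmetries_unbounded`).

The rest is operator theory. Approximate eigenvectors of the closure can be taken in the domain of
`T`, that is, with compact support. Displacing them one after the other makes them orthonormal,
hence weakly convergent to zero, which shows that the approximate point spectrum is contained in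
the Weyl spectrum. An eigenspace of the closure is invariant under the symmetries. If it were
nonzero and of finite dimension, an orthonormal basis could be approximated by compactly supported
sections, and some symmetry would move a unit vector of the eigenspace to one almost orthogonal to that
basis, which is impossible inside the eigenspace.

The operator theory uses only that the graph of the closure lies in the closure of the graph of `T`
and is invariant under the symmetries.
-/

namespace SectionOperator

/-! ### Unbounded operators with displacing symmetries -/

section Abstract

variable {𝕜 : Type*} [RCLike 𝕜] {W : Type*} [NormedAddCommGroup W] [InnerProductSpace 𝕜 W]

/-- The unbounded operator `T` has displacing symmetries with respect to the set `S` of vectors: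
for finitely many vectors of `S` there is an isometry that preserves `S` and the graph of `T`, and
that moves each of these vectors to a vector orthogonal to all of them. -/
def HasDisplacingSymmetries (T : W →ₗ.[𝕜] W) (S : Set W) : Prop :=
  ∀ s : Finset W, (s : Set W) ⊆ S → ∃ U : W →ₗᵢ[𝕜] W, MapsTo U S S ∧
    (∀ p ∈ T.graph, (U p.1, U p.2) ∈ T.graph) ∧ ∀ u ∈ s, ∀ v ∈ s, inner 𝕜 (U u) v = 0

lemma weylSpectrum_subset_approximatePointSpectrum (A : W →ₗ.[𝕜] W) :
    weylSpectrum A ⊆ approximatePointSpectrum A :=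
  fun _ ⟨v, h1, _, h2⟩ => ⟨v, h1, h2⟩

/-- Equality holds if `T` is closable. Otherwise `T.closure` is `T` by convention, and the inclusion
still holds. -/
lemma graph_closure_subset (T : W →ₗ.[𝕜] W) :
    (T.closure.graph : Set (W × W)) ⊆ closure (T.graph : Set (W × W)) := by
  by_cases hT : T.IsClosable
  · rw [← hT.graph_closure_eq_closure_graph, Submodule.topologicalClosure_coe]
  · rw [LinearPMap.closure_def' hT]
    exact subset_closure

lemma mapsTo_graph_closure {T : W →ₗ.[𝕜] W} {U : W →ₗᵢ[𝕜] W}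
    (hU : ∀ p ∈ T.graph, (U p.1, U p.2) ∈ T.graph) :
    ∀ p ∈ T.closure.graph, (U p.1, U p.2) ∈ T.closure.graph := by
  by_cases hT : T.IsClosable
  · have hc : Continuous fun p : W × W => (U p.1, U p.2) := by fun_prop
    have h : MapsTo (fun p : W × W => (U p.1, U p.2)) (T.graph : Set (W × W)) T.graph := hU
    rw [← hT.graph_closure_eq_closure_graph]
    exact fun p hp => h.closure hc hp
  · rwa [LinearPMap.closure_def' hT]

/-- Approximate eigenvectors of the closure can be taken in the original domain. -/
lemma exists_approx_eigenvector {T : W →ₗ.[𝕜] W} {z : 𝕜}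
    (hz : z ∈ approximatePointSpectrum T.closure) {ε : ℝ} (hε : 0 < ε) :
    ∃ p ∈ T.graph, ‖p.1‖ = 1 ∧ ‖p.2 - z • p.1‖ < ε := by
  obtain ⟨v, hv1, hv⟩ := hz
  obtain ⟨k, hk⟩ := ((Metric.tendsto_nhds.1 hv) ε hε).exists
  rw [dist_zero_right] at hk
  have hopen : IsOpen {p : W × W | p.1 ≠ 0 ∧ ‖p.2 - z • p.1‖ < ε * ‖p.1‖} :=
    (isOpen_ne_fun continuous_fst continuous_const).inter
      (isOpen_lt (f := fun p : W × W => ‖p.2 - z • p.1‖) (g := fun p => ε * ‖p.1‖)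
        (by fun_prop) (by fun_prop))
  have hmem := graph_closure_subset T (T.closure.mem_graph (v k))
  obtain ⟨p, ⟨hp0, hp⟩, hpT⟩ := mem_closure_iff.1 hmem _ hopen
    ⟨norm_ne_zero_iff.1 (by rw [hv1 k]; exact one_ne_zero), by rw [hv1 k, mul_one]; exact hk⟩
  have hpos : 0 < ‖p.1‖ := norm_pos_iff.2 hp0
  refine ⟨((‖p.1‖ : 𝕜)⁻¹) • p, T.graph.smul_mem _ hpT, ?_, ?_⟩
  · rw [Prod.smul_fst, norm_smul, norm_inv, RCLike.norm_ofReal, abs_norm,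
      inv_mul_cancel₀ hpos.ne']
  · rw [Prod.smul_fst, Prod.smul_snd, smul_comm z, ← smul_sub, norm_smul, norm_inv,
      RCLike.norm_ofReal, abs_norm, inv_mul_lt_iff₀ hpos, mul_comm]
    exact hp

lemma _root_.Orthonormal.tendsto_inner_zero {e : ℕ → W} (he : Orthonormal 𝕜 e) (w : W) :
    Tendsto (fun k => inner 𝕜 w (e k)) atTop (𝓝 0) := by
  have h := (he.inner_products_summable (x := w)).tendsto_atTop_zero
  rw [tendsto_zero_iff_norm_tendsto_zero]
  have h2 := h.sqrt
  simp only [Real.sqrt_zero, Real.sqrt_sq (norm_nonneg _)] at h2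
  simpa only [norm_inner_symm] using h2

/-- Displacing approximate eigenvectors one after the other off the previous ones makes them an
orthonormal sequence, which converges weakly to zero. -/
lemma HasDisplacingSymmetries.approximatePointSpectrum_closure_subset {T : W →ₗ.[𝕜] W} {S : Set W}
    (h : HasDisplacingSymmetries T S) (hTS : (T.domain : Set W) ⊆ S) :
    approximatePointSpectrum T.closure ⊆ weylSpectrum T.closure := by
  classical
  intro z hz
  -- The index `q.1` records the quality `1 / (q.1 + 1)` of the approximate eigenvector `q.2.1`.
  obtain ⟨f, hf, hr⟩ := exists_seq_of_forall_finset_exists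
    (fun q : ℕ × W × W => q.2 ∈ T.graph ∧ ‖q.2.1‖ = 1 ∧ ‖q.2.2 - z • q.2.1‖ < 1 / ((q.1 : ℝ) + 1))
    (fun q r => q.1 < r.1 ∧ inner 𝕜 r.2.1 q.2.1 = 0) (by
      intro s hs
      obtain ⟨n, hn⟩ : ∃ n : ℕ, ∀ q ∈ s, q.1 < n :=
        ⟨s.sup Prod.fst + 1, fun q hq => Nat.lt_succ_of_le (Finset.le_sup (f := Prod.fst) hq)⟩
      obtain ⟨p, hp, hp1, hpz⟩ := exists_approx_eigenvector hz (ε := 1 / ((n : ℝ) + 1))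
        (by positivity)
      obtain ⟨U, -, hUT, hU⟩ := h (insert p.1 (s.image fun q => q.2.1)) (by
        intro u hu
        apply hTS
        simp only [Finset.coe_insert, Finset.coe_image, mem_insert_iff, mem_image] at hu
        rcases hu with rfl | ⟨q, hq, rfl⟩
        · exact T.mem_domain_of_mem_graph hp
        · exact T.mem_domain_of_mem_graph (hs q hq).1)
      refine ⟨(n, U p.1, U p.2), ⟨hUT p hp, by simpa using hp1, ?_⟩, fun q hq => ⟨hn q hq, ?_⟩⟩
      · rw [← map_smul, ← map_sub, U.norm_map]
        exact hpz
      · exact hU _ (Finset.mem_insert_self _ _) _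
          (Finset.mem_insert_of_mem (Finset.mem_image_of_mem _ hq)))
  have hmono : StrictMono fun k => (f k).1 := fun k l hkl => (hr k l hkl).1
  have horth : Orthonormal 𝕜 fun k => (f k).2.1 := by
    refine ⟨fun k => (hf k).2.1, fun k l hkl => ?_⟩
    rcases lt_or_gt_of_ne hkl with hlt | hlt
    · exact inner_eq_zero_symm.1 (hr k l hlt).2
    · exact (hr l k hlt).2
  have hgr : ∀ k, (f k).2 ∈ T.closure.graph := fun k =>
    LinearPMap.le_graph_of_le T.le_closure (hf k).1
  have hex := fun k => (LinearPMap.mem_graph_iff _).1 (hgr k)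
  choose v hv hAv using hex
  refine ⟨v, fun k => ?_, fun w => ?_, ?_⟩
  · rw [hv]
    exact (hf k).2.1
  · simp only [hv]
    exact horth.tendsto_inner_zero w
  · simp only [hv, hAv]
    refine squeeze_zero_norm (fun k => (hf k).2.2.le.trans ?_)
      tendsto_one_div_add_atTop_nhds_zero_nat
    exact one_div_le_one_div_of_le (by positivity)
      (by simpa using (Nat.cast_le (α := ℝ)).2 (hmono.le_apply (x := k)))

/-- A nonzero finite-dimensional subspace can be displaced to a subspace that is almost orthogonal
to it, hence it is not invariant under all the symmetries. -/
lemma HasDisplacingSymmetries.not_finiteDimensional {T : W →ₗ.[𝕜] W} {S : Set W}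
    (h : HasDisplacingSymmetries T S) (hS : Dense S) (N : Submodule 𝕜 W) (hN : N ≠ ⊥)
    (hinv : ∀ U : W →ₗᵢ[𝕜] W, (∀ p ∈ T.graph, (U p.1, U p.2) ∈ T.graph) → ∀ v ∈ N, U v ∈ N) :
    ¬ FiniteDimensional 𝕜 N := by
  classical
  intro hfin
  obtain ⟨w, hw, hw1⟩ : ∃ w ∈ N, ‖w‖ = 1 := by
    obtain ⟨w, hw, hw0⟩ := N.exists_mem_ne_zero_of_ne_bot hN
    exact ⟨(‖w‖⁻¹ : 𝕜) • w, N.smul_mem _ hw, norm_smul_inv_norm hw0⟩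
  set e := stdOrthonormalBasis 𝕜 N
  set n := Module.finrank 𝕜 N
  -- With this `ε`, the `n` coordinates of `U w`, each at most `3 ε`, add up to less than `1`.
  set ε : ℝ := 1 / (3 * (n + 1))
  have hε : 0 < ε := by positivity
  have hε1 : ε ≤ 1 := by
    rw [div_le_one (by positivity)]
    linarith [(Nat.cast_nonneg n : (0 : ℝ) ≤ n)]
  obtain ⟨w', hw'S, hw'⟩ := Metric.dense_iff.1 hS w ε hε
  have hex : ∀ i, ∃ y ∈ S, ‖y - (e i : W)‖ < ε := fun i => by
    obtain ⟨y, hy, hyS⟩ := Metric.dense_iff.1 hS (e i : W) ε hε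
    exact ⟨y, hyS, by simpa [dist_eq_norm] using hy⟩
  choose y hyS hy using hex
  rw [Metric.mem_ball, dist_eq_norm] at hw'S
  obtain ⟨U, -, hUT, hU⟩ := h (insert w' (Finset.univ.image y)) (by
    intro u hu
    simp only [Finset.coe_insert, Finset.coe_image, mem_insert_iff, mem_image] at hu
    rcases hu with rfl | ⟨i, -, rfl⟩
    exacts [hw', hyS i])
  have hUw : U w ∈ N := hinv U hUT w hw
  have hnorm : ‖(⟨U w, hUw⟩ : N)‖ = 1 := by
    change ‖U w‖ = 1
    rw [U.norm_map, hw1]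
  -- The coordinates of `U w` are small, since `U w'` is orthogonal to each `y i`.
  have hcoord : ∀ i, ‖inner 𝕜 (U w) (e i : W)‖ < 3 * ε := fun i => by
    have h0 : inner 𝕜 (U w') (y i) = 0 := hU _ (Finset.mem_insert_self _ _) _
      (Finset.mem_insert_of_mem (Finset.mem_image_of_mem _ (Finset.mem_univ i)))
    have he1 : ‖(e i : W)‖ = 1 := e.orthonormal.1 i
    have hyn : ‖y i‖ ≤ 1 + ε := by
      have := norm_le_norm_add_norm_sub' (y i) (e i : W)
      rw [norm_sub_rev] at this
      linarith [norm_sub_rev (y i) (e i : W), hy i]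
    have hd : inner 𝕜 (U w) (e i : W)
        = -inner 𝕜 (U w) (y i - (e i : W)) - inner 𝕜 (U (w' - w)) (y i) := by
      rw [map_sub, inner_sub_right, inner_sub_left, h0]
      ring
    rw [hd]
    calc _ ≤ ‖inner 𝕜 (U w) (y i - (e i : W))‖ + ‖inner 𝕜 (U (w' - w)) (y i)‖ := by
          refine (norm_sub_le _ _).trans ?_
          rw [norm_neg]
      _ ≤ 1 * ‖y i - (e i : W)‖ + ‖w' - w‖ * (1 + ε) := by
          refine add_le_add ((norm_inner_le_norm _ _).trans ?_)
            ((norm_inner_le_norm _ _).trans ?_)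
          · rw [U.norm_map, hw1]
          · rw [U.norm_map]
            gcongr
      _ < 3 * ε := by nlinarith [hy i, norm_nonneg (w' - w)]
  have hsum := e.sum_repr' ⟨U w, hUw⟩
  have hle : ‖(⟨U w, hUw⟩ : N)‖ ≤ n * (3 * ε) := by
    rw [← hsum]
    refine (norm_sum_le _ _).trans ?_
    refine (Finset.sum_le_card_nsmul _ _ (3 * ε) fun i _ => ?_).trans ?_
    · rw [norm_smul, e.orthonormal.1 i, mul_one, norm_inner_symm]
      exact (hcoord i).le
    · simp [n]
  rw [hnorm] at hle
  have : (n : ℝ) * (3 * ε) < 1 := by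
    have : (n : ℝ) * (3 * ε) = n / (n + 1) := by
      simp only [ε]
      field_simp
    rw [this, div_lt_one (by positivity)]
    linarith
  linarith

lemma HasDisplacingSymmetries.not_isEigenvalueOfFiniteMultiplicity {T : W →ₗ.[𝕜] W} {S : Set W}
    (h : HasDisplacingSymmetries T S) (hS : Dense S) (z : 𝕜) :
    ¬ IsEigenvalueOfFiniteMultiplicity T.closure z := by
  rintro ⟨hne, hfin⟩
  refine h.not_finiteDimensional hS ((eigenspace T.closure z).map T.closure.domain.subtype) ?_ ?_
    inferInstance
  · exact fun hb => hne (Submodule.map_injective_of_injective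
      (Submodule.subtype_injective _) (hb.trans (Submodule.map_bot _).symm))
  · rintro U hU _ ⟨v, hv, rfl⟩
    have hAv : T.closure v = z • (v : W) := sub_eq_zero.1 hv
    have hUv := mapsTo_graph_closure hU _ (T.closure.mem_graph v)
    obtain ⟨u, hu, hAu⟩ := (LinearPMap.mem_graph_iff _).1 hUv
    refine ⟨u, ?_, hu⟩
    change T.closure u - z • (u : W) = 0
    rw [hAu, hu, hAv, map_smul, sub_self]

end Abstract

/-! ### Isometries and the Riemannian volume -/

section Isometries

variable {m : ℕ} {H : Type*} [TopologicalSpace H]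
  {I : ModelWithCorners ℝ (EuclideanSpace ℝ (Fin m)) H}
  {M : Type*} [TopologicalSpace M] [ChartedSpace H M] [IsManifold I ∞ M]

variable (I) in
/-- The differential at `p` of the map `φ`, in the coordinates of the preferred charts at `c` and
`d`. -/
noncomputable def coordDerivative (φ : M → M) (c d p : M) :
    EuclideanSpace ℝ (Fin m) →L[ℝ] EuclideanSpace ℝ (Fin m) :=
  (trivializationAt (EuclideanSpace ℝ (Fin m))
      (fun x : M => TangentSpace I x) d).continuousLinearMapAt ℝ (φ p) ∘L (mfderiv I I φ p) ∘L
    (trivializationAt (EuclideanSpace ℝ (Fin m)) (fun x : M => TangentSpace I x) c).symmL ℝ p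

lemma hasFDerivWithinAt_coordDerivative {φ : M → M} {c d p : M} (hφ : MDifferentiableAt I I φ p)
    (hc : p ∈ (chartAt H c).source) (hd : φ p ∈ (chartAt H d).source) :
    HasFDerivWithinAt (extChartAt I d ∘ φ ∘ (extChartAt I c).symm) (coordDerivative I φ c d p)
      (range I) (extChartAt I c p) := by
  have : IsManifold I 1 M := IsManifold.of_le (n := ∞) (by simp)
  have hp : (extChartAt I c).symm (extChartAt I c p) = p :=
    (extChartAt I c).left_inv (by simpa using hc)
  have h1 : HasMFDerivWithinAt 𝓘(ℝ, EuclideanSpace ℝ (Fin m)) I (extChartAt I c).symm (range I)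
      (extChartAt I c p)
      (mfderivWithin 𝓘(ℝ, EuclideanSpace ℝ (Fin m)) I (extChartAt I c).symm (range I)
        (extChartAt I c p)) :=
    (mdifferentiableWithinAt_extChartAt_symm
      ((extChartAt I c).map_source (by simpa using hc))).hasMFDerivWithinAt
  rw [coordDerivative, TangentBundle.symmL_trivializationAt hc,
    TangentBundle.continuousLinearMapAt_trivializationAt hd]
  have h2 : HasMFDerivAt I I φ ((extChartAt I c).symm (extChartAt I c p)) (mfderiv I I φ p) := by
    rw [hp]
    exact hφ.hasMFDerivAt
  have h3 : HasMFDerivAt I 𝓘(ℝ, EuclideanSpace ℝ (Fin m)) (extChartAt I d)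
      (φ ((extChartAt I c).symm (extChartAt I c p)))
      (mfderiv I 𝓘(ℝ, EuclideanSpace ℝ (Fin m)) (extChartAt I d) (φ p)) := by
    rw [hp]
    exact (mdifferentiableAt_extChartAt hd).hasMFDerivAt
  exact ((h3.comp _ h2).comp_hasMFDerivWithinAt _ h1).hasFDerivWithinAt

variable [RiemannianBundle (fun x : M => TangentSpace I x)]

variable (I) in
/-- The diffeomorphism `φ` is an isometry of the Riemannian metric. -/
def IsRiemannianIsometry (φ : Diffeomorph I I M M ∞) : Prop :=
  ∀ (x : M) (v w : TangentSpace I x), inner ℝ (mfderiv I I φ x v) (mfderiv I I φ x w) = inner ℝ v w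

lemma mfderiv_coordVector (φ : M → M) {c d p : M} (hd : φ p ∈ (chartAt H d).source) (i : Fin m) :
    mfderiv I I φ p (coordVector I c p i) = ∑ k, (coordDerivative I φ c d p
      (EuclideanSpace.basisFun (Fin m) ℝ i)) k • coordVector I d (φ p) k := by
  have hb : φ p ∈ (trivializationAt (EuclideanSpace ℝ (Fin m))
    (fun x : M => TangentSpace I x) d).baseSet := by simpa using hd
  simp only [coordVector, ← map_smul, ← map_sum]
  have h : ∑ k, (coordDerivative I φ c d p (EuclideanSpace.basisFun (Fin m) ℝ i)) k •
      EuclideanSpace.basisFun (Fin m) ℝ k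
      = coordDerivative I φ c d p (EuclideanSpace.basisFun (Fin m) ℝ i) := by
    conv_rhs => rw [← (EuclideanSpace.basisFun (Fin m) ℝ).sum_repr
      (coordDerivative I φ c d p (EuclideanSpace.basisFun (Fin m) ℝ i))]
    simp
  rw [h]
  exact (Trivialization.symmL_continuousLinearMapAt _ hb _).symm

/-- The density transforms by the Jacobian determinant, since the Gram matrix of the coordinate
fields transforms to `Jᵀ G J`. -/
lemma IsRiemannianIsometry.volumeDensity_eq {φ : Diffeomorph I I M M ∞}
    (hφ : IsRiemannianIsometry I φ) {c d p : M} (hd : φ p ∈ (chartAt H d).source) :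
    volumeDensity I c p = |(coordDerivative I φ c d p).det| * volumeDensity I d (φ p) := by
  set J : Matrix (Fin m) (Fin m) ℝ := LinearMap.toMatrix
    (EuclideanSpace.basisFun (Fin m) ℝ).toBasis (EuclideanSpace.basisFun (Fin m) ℝ).toBasis
    (coordDerivative I φ c d p).toLinearMap with hJ
  have hJe : ∀ k i, J k i = (coordDerivative I φ c d p
      (EuclideanSpace.basisFun (Fin m) ℝ i)) k := by
    intro k i
    simp [hJ, LinearMap.toMatrix_apply]
  have hdet : (coordDerivative I φ c d p).det = J.det := by
    rw [hJ, ContinuousLinearMap.det, LinearMap.det_toMatrix]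
  have hG : Matrix.gram ℝ (coordVector I c p)
      = J.transpose * Matrix.gram ℝ (coordVector I d (φ p)) * J := by
    ext i j
    rw [Matrix.gram_apply, ← hφ, mfderiv_coordVector φ hd i, mfderiv_coordVector φ hd j]
    simp only [Matrix.mul_apply, Matrix.transpose_apply, Matrix.gram_apply, sum_inner, inner_sum,
      inner_smul_left, inner_smul_right, hJe, Finset.sum_mul]
    refine Finset.sum_congr rfl fun k _ => ?_
    rw [Finset.mul_sum]
    refine Finset.sum_congr rfl fun l _ => ?_
    simp only [conj_trivial]
    ring
  rw [volumeDensity, hG, Matrix.det_mul, Matrix.det_mul, Matrix.det_transpose, hdet, volumeDensity,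
    show J.det * (Matrix.gram ℝ (coordVector I d (φ p))).det * J.det
      = J.det ^ 2 * (Matrix.gram ℝ (coordVector I d (φ p))).det by ring,
    Real.sqrt_mul (sq_nonneg _), Real.sqrt_sq_eq_abs]

variable [MeasurableSpace M] [BorelSpace M]

lemma IsRiemannianIsometry.chartVolume_image {φ : Diffeomorph I I M M ∞}
    (hφ : IsRiemannianIsometry I φ) (c d : M) {S : Set M} (hS : MeasurableSet S)
    (hSc : S ⊆ (chartAt H c).source) (hSd : φ '' S ⊆ (chartAt H d).source) :
    chartVolume I d (φ '' S) = chartVolume I c S := by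
  have hφS : MeasurableSet (φ '' S) :=
    φ.toHomeomorph.toMeasurableEquiv.measurableSet_image.2 hS
  have hSd' : ∀ p ∈ S, φ p ∈ (chartAt H d).source := fun p hp => hSd (mem_image_of_mem φ hp)
  rw [chartVolume_apply I c hS, chartVolume_apply I d hφS, inter_eq_left.2 hSc, inter_eq_left.2 hSd]
  have himg : extChartAt I d '' (φ '' S)
      = (extChartAt I d ∘ φ ∘ (extChartAt I c).symm) '' (extChartAt I c '' S) := by
    rw [image_image, image_image]
    refine image_congr fun p hp => ?_
    rw [Function.comp_apply, Function.comp_apply, chart_leftInv I (hSc hp)]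
  have hinj : InjOn (extChartAt I d ∘ φ ∘ (extChartAt I c).symm) (extChartAt I c '' S) := by
    rintro _ ⟨p, hp, rfl⟩ _ ⟨q, hq, rfl⟩ h
    simp only [Function.comp_apply] at h
    rw [chart_leftInv I (hSc hp), chart_leftInv I (hSc hq)] at h
    rw [φ.injective ((extChartAt I d).injOn (by simpa using hSd' p hp)
      (by simpa using hSd' q hq) h)]
  have hder : ∀ y ∈ extChartAt I c '' S, HasFDerivWithinAt
      (extChartAt I d ∘ φ ∘ (extChartAt I c).symm)
      (coordDerivative I φ c d ((extChartAt I c).symm y)) (extChartAt I c '' S) y := by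
    rintro _ ⟨p, hp, rfl⟩
    rw [chart_leftInv I (hSc hp)]
    refine (hasFDerivWithinAt_coordDerivative (φ.mdifferentiable (by simp) p) (hSc hp)
      (hSd' p hp)).mono ?_
    rintro _ ⟨q, hq, rfl⟩
    simp [extChartAt]
  have hms := measurableSet_image_extChartAt I c hS hSc
  rw [himg, lintegral_image_eq_lintegral_abs_det_fderiv_mul volume hms hder hinj]
  refine setLIntegral_congr_fun hms ?_
  rintro _ ⟨p, hp, rfl⟩
  simp only [Function.comp_apply]
  rw [chart_leftInv I (hSc hp), chart_leftInv I (hSd' p hp), hφ.volumeDensity_eq (hSd' p hp),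
    ENNReal.ofReal_mul (abs_nonneg _)]

lemma IsRiemannianIsometry.measurePreserving_symm [SecondCountableTopology M]
    {φ : Diffeomorph I I M M ∞} (hφ : IsRiemannianIsometry I φ) :
    MeasurePreserving φ.symm (riemannianVolume I M) (riemannianVolume I M) := by
  have hmeas : Measurable φ.symm := φ.symm.continuous.measurable
  refine ⟨hmeas, ?_⟩
  -- It suffices to compare the measures on the sets of a countable cover that are mapped by `φ`
  -- from one chart domain to another.
  set U : M → Set M := fun x => (chartAt H x).source ∩ φ ⁻¹' (chartAt H (φ x)).source
  have hUo : ∀ x, IsOpen (U x) := fun x =>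
    (chartAt H x).open_source.inter ((chartAt H (φ x)).open_source.preimage φ.continuous)
  obtain ⟨s, hs, hsU⟩ := TopologicalSpace.countable_cover_nhds (f := U) fun x =>
    (hUo x).mem_nhds ⟨mem_chart_source H x, mem_chart_source H (φ x)⟩
  have := hs.to_subtype
  refine Measure.ext_of_iUnion_eq_univ (s := fun x : s => U x) (by rw [iUnion_coe_set]; exact hsU)
    fun x => Measure.ext fun T hT => ?_
  have hTU : MeasurableSet (T ∩ U x) := hT.inter (hUo x).measurableSet
  have himg : φ '' (T ∩ U x) ⊆ (chartAt H (φ x)).source := by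
    rintro _ ⟨p, hp, rfl⟩
    exact hp.2.2
  have hpre : φ.symm ⁻¹' (T ∩ U x) = φ '' (T ∩ U x) :=
    (φ.toEquiv.image_eq_preimage_symm _).symm
  have hφS : MeasurableSet (φ '' (T ∩ U x)) := hpre ▸ hmeas hTU
  rw [Measure.restrict_apply hT, Measure.restrict_apply hT, Measure.map_apply hmeas hTU, hpre,
    riemannianVolume_eq_chartVolume I (φ x) hφS himg,
    riemannianVolume_eq_chartVolume I (x : M) hTU (inter_subset_right.trans inter_subset_left)]
  exact hφ.chartVolume_image x (φ x) hTU (inter_subset_right.trans inter_subset_left) himg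

end Isometries

/-! ### Isometries and the inward normal -/

section HalfSpace

variable {E : Type*} [NormedAddCommGroup E] [NormedSpace ℝ E] {l : E →L[ℝ] ℝ} {p v : E}

lemma frontier_halfSpace (hl : l ≠ 0) : frontier {y | 0 ≤ l y} = {y | l y = 0} := by
  have h := (l.isOpenMap_of_ne_zero hl).preimage_frontier_eq_frontier_preimage l.continuous (Ici 0)
  rw [frontier_Ici] at h
  exact h.symm

lemma interior_halfSpace (hl : l ≠ 0) : interior {y | 0 ≤ l y} = {y | 0 < l y} := by
  have h := (l.isOpenMap_of_ne_zero hl).preimage_interior_eq_interior_preimage l.continuous (Ici 0)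
  rw [interior_Ici] at h
  exact h.symm

lemma eventually_add_smul_mem_frontier_iff (hl : l ≠ 0) (hp : l p = 0) :
    (∀ᶠ t : ℝ in 𝓝 0, p + t • v ∈ frontier {y | 0 ≤ l y}) ↔ l v = 0 := by
  simp only [frontier_halfSpace hl, mem_ofPred_eq, map_add, hp, map_smul, zero_add, smul_eq_mul,
    mul_eq_zero]
  refine ⟨fun h => ?_, fun h => Eventually.of_forall fun t => Or.inr h⟩
  obtain ⟨t, ht, ht0⟩ := ((h.filter_mono nhdsWithin_le_nhds).and
    (self_mem_nhdsWithin : Ioi (0 : ℝ) ∈ 𝓝[>] 0)).exists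
  exact ht.resolve_left (ne_of_gt ht0)

lemma eventually_add_smul_mem_interior_iff (hl : l ≠ 0) (hp : l p = 0) :
    (∀ᶠ t : ℝ in 𝓝[>] 0, p + t • v ∈ interior {y | 0 ≤ l y}) ↔ 0 < l v := by
  simp only [interior_halfSpace hl, mem_ofPred_eq, map_add, hp, map_smul, zero_add, smul_eq_mul]
  refine ⟨fun h => ?_, fun h => ?_⟩
  · obtain ⟨t, ht, ht0⟩ := (h.and (self_mem_nhdsWithin : Ioi (0 : ℝ) ∈ 𝓝[>] 0)).exists
    exact pos_of_mul_pos_right ht (le_of_lt ht0)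
  · filter_upwards [self_mem_nhdsWithin] with t ht using mul_pos ht h

/-- The differential at a boundary point of a map between half-spaces preserves the half-space. -/
lemma nonneg_of_hasFDerivWithinAt_halfSpace {ψ : E → E} {L : E →L[ℝ] E}
    (hψ : HasFDerivWithinAt ψ L {y | 0 ≤ l y} p) (hmaps : ∀ y, 0 ≤ l (ψ y)) (hp : l p = 0)
    (hψp : l (ψ p) = 0) (hv : 0 ≤ l v) : 0 ≤ l (L v) := by
  have hmin : IsLocalMinOn (l ∘ ψ) {y | 0 ≤ l y} p :=
    Eventually.of_forall fun y => by simpa [hψp] using hmaps y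
  refine hmin.hasFDerivWithinAt_nonneg (f' := l ∘L L) (y := v)
    (l.hasFDerivAt.comp_hasFDerivWithinAt p hψ)
    (mem_posTangentConeAt_of_segment_subset ?_)
  rintro _ ⟨a, b, ha, hb, -, rfl⟩
  simpa [hp] using mul_nonneg hb hv

/-- A surjective linear map that preserves a half-space multiplies its defining functional by a
positive factor. -/
lemma exists_pos_factor_of_maps_halfSpace {L : E →L[ℝ] E} (hL : Function.Surjective L)
    (hl : l ≠ 0) (h : ∀ v, 0 ≤ l v → 0 ≤ l (L v)) : ∃ c : ℝ, 0 < c ∧ ∀ v, l (L v) = c * l v := by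
  obtain ⟨v₀, hv₀⟩ : ∃ v₀, l v₀ = 1 := LinearMap.surjective (f := l.toLinearMap)
    (fun h0 => hl (ContinuousLinearMap.coe_injective h0)) 1
  have hker : ∀ v, l v = 0 → l (L v) = 0 := fun v hv => by
    refine le_antisymm ?_ (h v hv.ge)
    simpa using h (-v) (by simp [hv])
  have hfac : ∀ v, l (L v) = l (L v₀) * l v := fun v => by
    have := hker (v - l v • v₀) (by simp [hv₀])
    rw [map_sub, map_sub, map_smul, map_smul, smul_eq_mul, sub_eq_zero] at this
    rw [this, mul_comm]
  refine ⟨l (L v₀), lt_of_le_of_ne (h v₀ (by simp [hv₀])) fun h0 => ?_, hfac⟩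
  obtain ⟨v, hv⟩ := hL v₀
  have := hfac v
  rw [hv, hv₀, ← h0, zero_mul] at this
  exact one_ne_zero this

end HalfSpace

section InwardNormal

variable {m : ℕ} {H : Type*} [TopologicalSpace H]
  {I : ModelWithCorners ℝ (EuclideanSpace ℝ (Fin m)) H}
  {M : Type*} [TopologicalSpace M] [ChartedSpace H M] [IsManifold I ∞ M]

lemma surjective_mfderiv (φ : Diffeomorph I I M M ∞) (x : M) :
    Function.Surjective (mfderiv I I φ x) :=
  (φ.mfderivToContinuousLinearEquiv (by simp) (x := x)).surjective

variable [IsSmoothBoundaryModel I]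

/-- At a boundary point, diffeomorphisms preserve the tangency to the boundary and the inward
direction. -/
lemma mfderiv_boundary_iff (φ : Diffeomorph I I M M ∞) {x : M} (hx : x ∈ I.boundary M)
    (v : TangentSpace I x) :
    (IsTangentToBoundary I (mfderiv I I φ x v) ↔ IsTangentToBoundary I v) ∧
      (IsInwardPointing I (mfderiv I I φ x v) ↔ IsInwardPointing I v) := by
  have hφx : φ x ∈ I.boundary M := by
    rwa [← φ.preimage_boundary (by simp)] at hx
  change extChartAt I x x ∈ frontier (range I) at hx
  change extChartAt I (φ x) (φ x) ∈ frontier (range I) at hφx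
  rcases IsSmoothBoundaryModel.range_eq (I := I) with hI | ⟨l, hl, hI⟩
  · simp [hI] at hx
  rw [hI, frontier_halfSpace hl] at hx hφx
  have hder := (φ.mdifferentiable (by simp) x).hasMFDerivAt.2
  rw [hI] at hder
  -- The local expression of `φ` takes values in the half-space, so its differential preserves it.
  have hψ : writtenInExtChartAt I I x φ (extChartAt I x x) = extChartAt I (φ x) (φ x) := by
    simp [writtenInExtChartAt]
  obtain ⟨c, hc, hcl⟩ := exists_pos_factor_of_maps_halfSpace
    (L := (mfderiv I I φ x : EuclideanSpace ℝ (Fin m) →L[ℝ] EuclideanSpace ℝ (Fin m)))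
    (surjective_mfderiv φ x) hl fun v hv =>
      nonneg_of_hasFDerivWithinAt_halfSpace hder (fun y => by
        have : writtenInExtChartAt I I x φ y ∈ range I := by simp [writtenInExtChartAt, extChartAt]
        rwa [hI] at this) hx (by rw [hψ]; exact hφx) hv
  have hv := hcl (tangentCoord I v)
  change l (tangentCoord I (mfderiv I I φ x v)) = _ at hv
  rw [IsTangentToBoundary, IsTangentToBoundary, IsInwardPointing, IsInwardPointing, hI,
    eventually_add_smul_mem_frontier_iff hl hx, eventually_add_smul_mem_frontier_iff hl hφx,
    eventually_add_smul_mem_interior_iff hl hx, eventually_add_smul_mem_interior_iff hl hφx, hv]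
  exact ⟨by simp [hc.ne'], by simp [hc]⟩

variable [RiemannianBundle (fun x : M => TangentSpace I x)]

lemma IsRiemannianIsometry.isInwardNormal_of_mfderiv {φ : Diffeomorph I I M M ∞}
    (hφ : IsRiemannianIsometry I φ) {x : M} (hx : x ∈ I.boundary M) {n : TangentSpace I x}
    (hn : IsInwardNormal I (mfderiv I I φ x n)) : IsInwardNormal I n := by
  obtain ⟨h1, h2, h3⟩ := hn
  refine ⟨?_, fun v hv => ?_, (mfderiv_boundary_iff φ hx n).2.1 h3⟩
  · rw [← h1, @norm_eq_sqrt_real_inner _ _ _ n, @norm_eq_sqrt_real_inner _ _ _ (mfderiv I I φ x n),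
      hφ]
  · rw [← hφ]
    exact h2 _ ((mfderiv_boundary_iff φ hx v).1.2 hv)

end InwardNormal

/-! ### The action of bundle automorphisms on `L²(E)` -/

section Action

variable {𝕜 : Type*} [RCLike 𝕜] {m : ℕ} {H : Type*} [TopologicalSpace H]
  {I : ModelWithCorners ℝ (EuclideanSpace ℝ (Fin m)) H}
  {M : Type*} [TopologicalSpace M] [ChartedSpace H M]
  {F : Type*} [NormedAddCommGroup F] [NormedSpace 𝕜 F] [NormedSpace ℝ F] [IsScalarTower ℝ 𝕜 F]
  {V : M → Type*} [TopologicalSpace (TotalSpace F V)]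
  [∀ x, NormedAddCommGroup (V x)] [∀ x, InnerProductSpace 𝕜 (V x)]
  [∀ x, NormedSpace ℝ (V x)]
  [FiberBundle F V] [VectorBundle 𝕜 F V] [VectorBundle ℝ F V]

lemma CompactSections.isCompact_closure_support
    (η : CompactSections 𝕜 I F V) : IsCompact (closure {x | η.toSmooth.1 x ≠ 0}) := η.2

namespace MetricBundleAut

/-- `g_* η` at `g x`, without a cast between fibers. -/
lemma pushforward_base (g : MetricBundleAut 𝕜 I F V) (η : smoothSections 𝕜 I F V) (x : M) :
    (g.pushforward η).1 (g.base x) = g.fiber x (η.1 x) := by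
  have h : (⟨g.base x, (g.pushforward η).1 (g.base x)⟩ : TotalSpace F V)
      = ⟨g.base x, g.fiber x (η.1 x)⟩ := by
    refine (mk_fiberCast 𝕜 F (g.base.apply_symm_apply (g.base x)) _).trans ?_
    rw [g.base.symm_apply_apply x]
  simpa using h

lemma pushforward_add (g : MetricBundleAut 𝕜 I F V) (η θ : smoothSections 𝕜 I F V) :
    g.pushforward (η + θ) = g.pushforward η + g.pushforward θ := by
  refine Subtype.ext (funext fun y => ?_)
  simp [pushforward]

lemma pushforward_smul (g : MetricBundleAut 𝕜 I F V) (c : 𝕜) (η : smoothSections 𝕜 I F V) :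
    g.pushforward (c • η) = c • g.pushforward η := by
  refine Subtype.ext (funext fun y => ?_)
  simp [pushforward]

lemma inner_pushforward (g : MetricBundleAut 𝕜 I F V) (η θ : smoothSections 𝕜 I F V) (y : M) :
    inner 𝕜 ((g.pushforward η).1 y) ((g.pushforward θ).1 y)
      = inner 𝕜 (η.1 (g.base.symm y)) (θ.1 (g.base.symm y)) := by
  simp [pushforward]

lemma support_pushforward (g : MetricBundleAut 𝕜 I F V) (η : smoothSections 𝕜 I F V) :
    {y | (g.pushforward η).1 y ≠ 0} = g.base '' {x | η.1 x ≠ 0} := by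
  ext y
  obtain ⟨x, rfl⟩ : ∃ x, g.base x = y := ⟨_, g.base.apply_symm_apply y⟩
  have hinj : Function.Injective g.base := g.base.injective
  rw [mem_ofPred_eq, pushforward_base, hinj.mem_set_image, mem_ofPred_eq]
  simp

/-- The push-forward of compactly supported smooth sections, as a linear map. -/
noncomputable def pushforwardCompact (g : MetricBundleAut 𝕜 I F V) :
    CompactSections 𝕜 I F V →ₗ[𝕜] CompactSections 𝕜 I F V where
  toFun η := ⟨g.pushforward η.toSmooth, by
    change IsCompact (closure {y | (g.pushforward η.toSmooth).1 y ≠ 0})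
    rw [support_pushforward]
    have h2 := g.base.toHomeomorph.image_closure {x | η.toSmooth.1 x ≠ 0}
    rw [g.base.coe_toHomeomorph] at h2
    rw [← h2]
    exact η.isCompact_closure_support.image g.base.continuous⟩
  map_add' η θ := Subtype.ext (by
    change g.pushforward (η + θ).toSmooth = g.pushforward η.toSmooth + g.pushforward θ.toSmooth
    rw [map_add, pushforward_add])
  map_smul' c η := Subtype.ext (by
    change g.pushforward (c • η).toSmooth = c • g.pushforward η.toSmooth
    rw [map_smul, pushforward_smul])

lemma toSmooth_pushforwardCompact (g : MetricBundleAut 𝕜 I F V) (η : CompactSections 𝕜 I F V) :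
    (g.pushforwardCompact η).toSmooth = g.pushforward η.toSmooth := rfl

end MetricBundleAut

variable [IsManifold I ∞ M] [RiemannianBundle (fun x : M => TangentSpace I x)]

/-- Push-forward under an isometric automorphism that preserves the boundary data preserves the
boundary condition. -/
lemma MetricBundleAut.pushforwardCompact_mem_boundaryDomain [IsSmoothBoundaryModel I]
    (g : MetricBundleAut 𝕜 I F V) (hg : g.IsIsometric) {nabla : Connection 𝕜 I F V}
    {a b : I.boundary M → 𝕜}
    (hnabla : ∀ (η : smoothSections 𝕜 I F V) (x : I.boundary M) (v : TangentSpace I (x : M)),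
      nabla.toFun (g.pushforward η).1 (g.base x) (mfderiv I I g.base x v)
        = g.fiber x (nabla.toFun η.1 x v))
    (ha : ∀ x y : I.boundary M, (y : M) = g.base x → a y = a x)
    (hb : ∀ x y : I.boundary M, (y : M) = g.base x → b y = b x)
    {η : CompactSections 𝕜 I F V} (hη : η ∈ boundaryDomain nabla a b) :
    g.pushforwardCompact η ∈ boundaryDomain nabla a b := by
  rintro ⟨y, hy⟩ n hn
  obtain ⟨x, rfl⟩ : ∃ x, g.base x = y := ⟨_, g.base.apply_symm_apply y⟩
  have hx : x ∈ I.boundary M := by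
    rwa [← g.base.preimage_boundary (by simp)]
  obtain ⟨v, rfl⟩ := surjective_mfderiv g.base x n
  have hv : IsInwardNormal I v :=
    IsRiemannianIsometry.isInwardNormal_of_mfderiv (φ := g.base) hg hx hn
  have h := hη ⟨x, hx⟩ v hv
  rw [toSmooth_pushforwardCompact, ha ⟨x, hx⟩ ⟨_, hy⟩ rfl, hb ⟨x, hx⟩ ⟨_, hy⟩ rfl]
  have h1 := hnabla η.toSmooth ⟨x, hx⟩ v
  have h2 := congrArg (g.fiber x) h
  rw [map_add, map_smul, map_smul, map_zero] at h2
  rw [pushforward_base]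
  refine Eq.trans ?_ h2
  rw [← h1]

variable [T2Space M] [SecondCountableTopology M]
  [IsContMDiffRiemannianBundle I ∞ (EuclideanSpace ℝ (Fin m)) (fun x : M => TangentSpace I x)]
  [MeasurableSpace M] [BorelSpace M] [IsSmoothMetricBundle 𝕜 I F V]

lemma CompactSections.inner_def (η θ : CompactSections 𝕜 I F V) :
    inner 𝕜 η θ = ∫ x, inner 𝕜 (η.toSmooth.1 x) (θ.toSmooth.1 x) ∂(riemannianVolume I M) := rfl

lemma CompactSections.inner_eq_zero_of_disjoint {η θ : CompactSections 𝕜 I F V}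
    (h : Disjoint {x | η.toSmooth.1 x ≠ 0} {x | θ.toSmooth.1 x ≠ 0}) : inner 𝕜 η θ = 0 := by
  rw [inner_def]
  refine integral_eq_zero_of_ae (Eventually.of_forall fun x => ?_)
  by_cases hx : η.toSmooth.1 x = 0
  · simp [hx]
  · have : θ.toSmooth.1 x = 0 := not_not.1 fun h2 => disjoint_left.1 h hx h2
    simp [this]

namespace MetricBundleAut

lemma inner_pushforwardCompact {g : MetricBundleAut 𝕜 I F V} (hg : g.IsIsometric)
    (η θ : CompactSections 𝕜 I F V) :
    inner 𝕜 (g.pushforwardCompact η) (g.pushforwardCompact θ) = inner 𝕜 η θ := by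
  simp only [CompactSections.inner_def, toSmooth_pushforwardCompact, inner_pushforward]
  exact (IsRiemannianIsometry.measurePreserving_symm (φ := g.base) hg).integral_comp
    g.base.symm.toHomeomorph.measurableEmbedding
    fun x => inner 𝕜 (η.toSmooth.1 x) (θ.toSmooth.1 x)

/-- The isometry of `L²(E)` induced by an isometric automorphism. -/
noncomputable def pushforwardL2 (g : MetricBundleAut 𝕜 I F V) (hg : g.IsIsometric) :
    L2Sections 𝕜 I F V →ₗᵢ[𝕜] L2Sections 𝕜 I F V :=
  let f := (g.pushforwardCompact.isometryOfInner (inner_pushforwardCompact hg))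
  { toLinearMap := (f.toContinuousLinearMap.completion).toLinearMap
    norm_map' := fun w => by
      refine UniformSpace.Completion.induction_on w
        (isClosed_eq (f.toContinuousLinearMap.completion.continuous.norm) continuous_norm)
        fun η => ?_
      change ‖f.toContinuousLinearMap.completion η‖ = _
      rw [ContinuousLinearMap.completion_apply_coe, UniformSpace.Completion.norm_coe,
        UniformSpace.Completion.norm_coe]
      exact f.norm_map η }

lemma pushforwardL2_toL2 (g : MetricBundleAut 𝕜 I F V) (hg : g.IsIsometric)
    (η : CompactSections 𝕜 I F V) :
    g.pushforwardL2 hg (CompactSections.toL2 𝕜 I F V η)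
      = CompactSections.toL2 𝕜 I F V (g.pushforwardCompact η) :=
  ContinuousLinearMap.completion_apply_coe _ _

end MetricBundleAut

lemma CompactSections.inner_toL2 (η θ : CompactSections 𝕜 I F V) :
    inner 𝕜 (toL2 𝕜 I F V η) (toL2 𝕜 I F V θ) = inner 𝕜 η θ :=
  UniformSpace.Completion.inner_coe η θ

lemma CompactSections.dense_range_toL2 : Dense (range (toL2 𝕜 I F V)) :=
  UniformSpace.Completion.denseRange_coe

lemma DifferentialOperator.unbounded_apply (D : DifferentialOperator 𝕜 I F V)
    (nabla : Connection 𝕜 I F V) (a b : I.boundary M → 𝕜) (η : boundaryDomain nabla a b) :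
    D.unbounded nabla a b (Submodule.equivMapOfInjective (CompactSections.toL2 𝕜 I F V)
        CompactSections.toL2_injective (boundaryDomain nabla a b) η)
      = CompactSections.toL2 𝕜 I F V (D.onCompact η) := by
  refine congrArg (fun θ : boundaryDomain nabla a b =>
    CompactSections.toL2 𝕜 I F V (D.onCompact θ)) ?_
  exact LinearEquiv.symm_apply_apply _ η

lemma DifferentialOperator.mem_graph_unbounded (D : DifferentialOperator 𝕜 I F V)
    (nabla : Connection 𝕜 I F V) (a b : I.boundary M → 𝕜) {η : CompactSections 𝕜 I F V}
    (hη : η ∈ boundaryDomain nabla a b) :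
    (CompactSections.toL2 𝕜 I F V η, CompactSections.toL2 𝕜 I F V (D.onCompact η)) ∈
      (D.unbounded nabla a b).graph :=
  (LinearPMap.mem_graph_iff _).2 ⟨_, rfl, D.unbounded_apply nabla a b ⟨η, hη⟩⟩

lemma DifferentialOperator.exists_of_mem_graph_unbounded (D : DifferentialOperator 𝕜 I F V)
    (nabla : Connection 𝕜 I F V) (a b : I.boundary M → 𝕜)
    {p : L2Sections 𝕜 I F V × L2Sections 𝕜 I F V} (hp : p ∈ (D.unbounded nabla a b).graph) :
    ∃ η ∈ boundaryDomain nabla a b,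
      p = (CompactSections.toL2 𝕜 I F V η, CompactSections.toL2 𝕜 I F V (D.onCompact η)) := by
  obtain ⟨u, hu, hTu⟩ := (LinearPMap.mem_graph_iff _).1 hp
  obtain ⟨η, rfl⟩ := (Submodule.equivMapOfInjective (CompactSections.toL2 𝕜 I F V)
    CompactSections.toL2_injective (boundaryDomain nabla a b)).surjective u
  exact ⟨η, η.2, Prod.ext hu.symm (hTu.symm.trans (D.unbounded_apply nabla a b η))⟩

lemma MetricBundleAut.onCompact_pushforwardCompact {D : DifferentialOperator 𝕜 I F V}
    {g : MetricBundleAut 𝕜 I F V} (hD : ∀ η : smoothSections 𝕜 I F V,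
      D.toLinearMap (g.pushforward η) = g.pushforward (D.toLinearMap η))
    (η : CompactSections 𝕜 I F V) :
    D.onCompact (g.pushforwardCompact η) = g.pushforwardCompact (D.onCompact η) :=
  Subtype.ext (hD η.toSmooth)

/-- A group of isometric automorphisms that commute with `D`, preserve the boundary condition and
move each compact subset of `M` off itself yields displacing symmetries of `D`. -/
lemma DifferentialOperator.hasDisplacingSymmetries_unbounded [IsSmoothBoundaryModel I]
    {nabla : Connection 𝕜 I F V} {D : DifferentialOperator 𝕜 I F V} {a b : I.boundary M → 𝕜}
    {Γ : Subgroup (MetricBundleAut 𝕜 I F V)} (hisometric : ∀ g ∈ Γ, g.IsIsometric)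
    (hD : ∀ g ∈ Γ, ∀ η : smoothSections 𝕜 I F V,
      D.toLinearMap (g.pushforward η) = g.pushforward (D.toLinearMap η))
    (hdomain : ∀ g ∈ Γ, ∀ η ∈ boundaryDomain nabla a b,
      g.pushforwardCompact η ∈ boundaryDomain nabla a b)
    (hcompact : ∀ K : Set M, IsCompact K → ∃ g ∈ Γ, g.base '' K ∩ K = ∅) :
    HasDisplacingSymmetries (D.unbounded nabla a b) (range (CompactSections.toL2 𝕜 I F V)) := by
  classical
  intro s hs
  choose! f hf using fun u (hu : u ∈ s) => hs hu
  obtain ⟨g, hg, hK⟩ := hcompact (⋃ u ∈ s, closure {x | (f u).toSmooth.1 x ≠ 0})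
    (s.isCompact_biUnion fun u _ => (f u).isCompact_closure_support)
  refine ⟨g.pushforwardL2 (hisometric g hg), ?_, ?_, fun u hu v hv => ?_⟩
  · rintro _ ⟨η, rfl⟩
    exact ⟨_, (g.pushforwardL2_toL2 _ η).symm⟩
  · intro p hp
    obtain ⟨η, hη, rfl⟩ := D.exists_of_mem_graph_unbounded nabla a b hp
    rw [g.pushforwardL2_toL2, g.pushforwardL2_toL2, ← g.onCompact_pushforwardCompact (hD g hg)]
    exact D.mem_graph_unbounded nabla a b (hdomain g hg η hη)
  · rw [← hf u hu, ← hf v hv, g.pushforwardL2_toL2, CompactSections.inner_toL2]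
    refine CompactSections.inner_eq_zero_of_disjoint ?_
    have hsub : ∀ w ∈ s, {x | (f w).toSmooth.1 x ≠ 0} ⊆
        ⋃ u ∈ s, closure {x | (f u).toSmooth.1 x ≠ 0} := fun w hw =>
      subset_closure.trans
        (subset_biUnion_of_mem (u := fun u => closure {x | (f u).toSmooth.1 x ≠ 0}) hw)
    rw [g.toSmooth_pushforwardCompact, g.support_pushforward]
    exact (disjoint_iff_inter_eq_empty.2 hK).mono (image_mono (hsub u hu)) (hsub v hv)

end Action

end SectionOperator

theorem mainTheorem5
    {𝕜 : Type*} [RCLike 𝕜]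
    {m : ℕ} {H : Type*} [TopologicalSpace H]
    (I : ModelWithCorners ℝ (EuclideanSpace ℝ (Fin m)) H) [SectionOperator.IsSmoothBoundaryModel I]
    -- `M` is a connected Riemannian manifold with possibly empty smooth boundary
    {M : Type*} [TopologicalSpace M] [ChartedSpace H M] [IsManifold I ∞ M]
    [T2Space M] [SecondCountableTopology M] [ConnectedSpace M] [MeasurableSpace M] [BorelSpace M]
    [RiemannianBundle (fun x : M => TangentSpace I x)]
    [IsContMDiffRiemannianBundle I ∞ (EuclideanSpace ℝ (Fin m)) (fun x : M => TangentSpace I x)]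
    -- `V` is a smooth Riemannian (`𝕜 = ℝ`) or Hermitian (`𝕜 = ℂ`) vector bundle over `M`
    {F : Type*} [NormedAddCommGroup F] [NormedSpace 𝕜 F] [NormedSpace ℝ F] [IsScalarTower ℝ 𝕜 F]
    [FiniteDimensional 𝕜 F]
    {V : M → Type*} [TopologicalSpace (TotalSpace F V)]
    [∀ x, NormedAddCommGroup (V x)] [∀ x, InnerProductSpace 𝕜 (V x)]
    [∀ x, NormedSpace ℝ (V x)] [∀ x, IsScalarTower ℝ 𝕜 (V x)]
    [FiberBundle F V] [VectorBundle 𝕜 F V] [VectorBundle ℝ F V] [ContMDiffVectorBundle ∞ F V I]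
    [SectionOperator.IsSmoothMetricBundle 𝕜 I F V]
    -- the connection, the differential operator and the boundary data
    (nabla : SectionOperator.Connection 𝕜 I F V)
    (D : SectionOperator.DifferentialOperator 𝕜 I F V)
    (a b : I.boundary M → 𝕜)
    -- the group of automorphisms
    (Γ : Subgroup (SectionOperator.MetricBundleAut 𝕜 I F V))
    (hisometric : ∀ g ∈ Γ, g.IsIsometric)
    (hD : ∀ g ∈ Γ, ∀ η : SectionOperator.smoothSections 𝕜 I F V,
      D.toLinearMap (g.pushforward η) = g.pushforward (D.toLinearMap η))
    -- `∇`, `a` and `b` are `Γ`-invariant along the boundary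
    (hnabla : ∀ g ∈ Γ, ∀ (η : SectionOperator.smoothSections 𝕜 I F V) (x : I.boundary M)
      (v : TangentSpace I (x : M)),
      nabla.toFun (g.pushforward η).1 (g.base x) (mfderiv I I g.base x v)
        = g.fiber x (nabla.toFun η.1 x v))
    (ha : ∀ g ∈ Γ, ∀ x y : I.boundary M, (y : M) = g.base x → a y = a x)
    (hb : ∀ g ∈ Γ, ∀ x y : I.boundary M, (y : M) = g.base x → b y = b x)
    (hcompact : ∀ K : Set M, IsCompact K → ∃ g ∈ Γ, g.base '' K ∩ K = ∅) :
    SectionOperator.approximatePointSpectrum (D.unbounded nabla a b).closure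
        = SectionOperator.weylSpectrum (D.unbounded nabla a b).closure ∧
      ∀ z : 𝕜, ¬ SectionOperator.IsEigenvalueOfFiniteMultiplicity
        (D.unbounded nabla a b).closure z := by
  have hsymm : SectionOperator.HasDisplacingSymmetries (D.unbounded nabla a b)
      (range (SectionOperator.CompactSections.toL2 𝕜 I F V)) :=
    D.hasDisplacingSymmetries_unbounded hisometric hD
      (fun g hg η hη => g.pushforwardCompact_mem_boundaryDomain (hisometric g hg) (hnabla g hg)
        (ha g hg) (hb g hg) hη) hcompact
  have hdomain : ((D.unbounded nabla a b).domain : Set (SectionOperator.L2Sections 𝕜 I F V)) ⊆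
      range (SectionOperator.CompactSections.toL2 𝕜 I F V) := by
    rintro _ ⟨η, -, rfl⟩
    exact mem_range_self η
  exact ⟨Subset.antisymm (hsymm.approximatePointSpectrum_closure_subset hdomain)
      (SectionOperator.weylSpectrum_subset_approximatePointSpectrum _),
    hsymm.not_isEigenvalueOfFiniteMultiplicity
      SectionOperator.CompactSections.dense_range_toL2⟩
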